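/- Let $A=\{(x_1,x_2,x_3)\in\mathbb R^3 : x_1+x_2+x_3=1\}$ and $D=\{x\in A : x_1\ge x_2\ge x_3\ge 0\}$. For $v,w\in A$ write $v\sim w$ if there is a permutation $\sigma$ of the coordinates such that either $v_i\equiv w_{\sigma(i)} \pmod 1$ for all $i$, or $v_i\equiv -w_{\sigma(i)}\pmod 1$ for all $i$. Let $G$ be the group of matrices generated by the transpositions of the first and third and of the second and third coordinates together with $(x,y,z)\mapsto(x+z,\,y+z,\,-z)$; on $A$ it acts as the wallpaper group $p6m$, generated by the reflections in the three sides of $D$. Let $R\subset A$ be the set of points with nontrivial stabilizer in $G$; it is the union of the reflection lines, that is, the intersections of $A$ with the planes $x_i=k$ and $x_i-x_j=k$ $(i\neq j,\ k\in\mathbb Z)$. An angle transition matrix (ATM) is an invertible real $3\times 3$ matrix $M$ with $MA\subset A$ such that $v\sim w$ implies $Mv\sim Mw$ for $v,w\in A$. The linear triangle map with ATM $M$ is the map $f:D\to D$ induced by $M$, i.e. $f(v)\sim Mv$ for all $v\in D$. Let $\mu$ be normalized Lebesgue (area) measure on $D$. **Corollary.** Let $f:D\to D$ be a linear triangle map with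 ATM $M$. 1. $MD$ is a triangle in $A$ with angles $30^\circ,60^\circ,90^\circ$; each of its edges is contained in $R$ and lies on a single reflection line. 2. $|\det M|$ is a natural number $n$, and there are $g_1,\dots,g_n\in G$ such that $MD=\bigcup_{i=1}^n g_iD$, where the tiles $g_iD$ have pairwise disjoint interiors relative to $A$. 3. The preimages $P_i=\{v\in D: Mv\in g_iD\}$, $1\le i\le n$, form a Markov partition of $D$ for $f$: they are nonempty, each is the closure of its interior in $D$, they cover $D$, their interiors in $D$ are pairwise disjoint, $f$ is continuous and injective on each $P_i$, and each $f(P_i)$ is a union of sets $P_j$. 4. If $|\det M|\neq 1$, then $f$ is semiconjugate to the one-sided Bernoulli shift $\sigma$ on $n$ symbols: there is a continuous surjection $h:\{1,\dots,n\}^{\mathbb N}\to D$ with $h\circ\sigma=f\circ h$ and $f^k(h(\omega))\in P_{\omega_k}$ for all $\omega$ and all $k\ge 0$, and $h$ carries the Bernoulli measure with equal weights $1/n$ to $\mu$. 5. If $|\det M|\neq 1$, then $f$ preserves $\mu$ and is mixing with respect to $\mu$, i.e. $\mu(f^{-k}S\cap T)\to\mu(S)\mu(T)$ as $k\to\infty$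 for all measurable $S,T\subset D$; hence $f$ is ergodic with respect to $\mu$. -/

import Mathlib

open Topology MeasureTheory

namespace TriangleDynamics

/-- The plane `x + y + z = 1` of (normalized, not necessarily principal) angle triples. -/
def anglePlane : Set (Fin 3 → ℝ) := {v | v 0 + v 1 + v 2 = 1}

/-- The fundamental domain: ordered triples of interior angles. -/
def D : Set (Fin 3 → ℝ) := {v | v ∈ anglePlane ∧ v 1 ≤ v 0 ∧ v 2 ≤ v 1 ∧ 0 ≤ v 2}

/-- `v` is a re-expression of `w`: up to a permutation of the coordinates and a global sign,
the coordinates agree modulo `1`. -/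
def Reexpr (v w : Fin 3 → ℝ) : Prop :=
  ∃ σ : Equiv.Perm (Fin 3),
    (∀ i, ∃ k : ℤ, v i = w (σ i) + k) ∨ (∀ i, ∃ k : ℤ, v i = -w (σ i) + k)

/-- The transposition of the first and third coordinates. -/
def P13 : Matrix (Fin 3) (Fin 3) ℝ := !![0, 0, 1; 0, 1, 0; 1, 0, 0]

/-- The transposition of the second and third coordinates. -/
def P23 : Matrix (Fin 3) (Fin 3) ℝ := !![1, 0, 0; 0, 0, 1; 0, 1, 0]

/-- On the angle plane this is the orthogonal reflection in the line `z = 0`. -/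
def Rz : Matrix (Fin 3) (Fin 3) ℝ := !![1, 0, 1; 0, 1, 1; 0, 0, -1]

/-- The wallpaper group `p6m`, as the matrix group generated by three reflections (of the angle
plane). Its action on the angle plane is matrix-vector multiplication. -/
def G : Subgroup (GL (Fin 3) ℝ) :=
  Subgroup.closure {g | (g : Matrix (Fin 3) (Fin 3) ℝ) ∈ ({P13, P23, Rz} : Set _)}

/-- The image `g S` of a set of triples under `g`. -/
def translate (g : GL (Fin 3) ℝ) (S : Set (Fin 3 → ℝ)) : Set (Fin 3 → ℝ) :=
  (fun v => (g : Matrix (Fin 3) (Fin 3) ℝ).mulVec v) '' S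

/-- The points of the angle plane whose point group (stabilizer in `G`) is nontrivial. -/
def reflectionSet : Set (Fin 3 → ℝ) :=
  {v | v ∈ anglePlane ∧ ∃ g ∈ G, g ≠ 1 ∧ (g : Matrix (Fin 3) (Fin 3) ℝ).mulVec v = v}

/-- The reflection lines: intersections of the angle plane with the planes
`x_i = k` and `x_i - x_j = k`, `k` an integer. -/
def IsReflectionLine (L : Set (Fin 3 → ℝ)) : Prop :=
  ∃ k : ℤ, (∃ i, L = {v | v ∈ anglePlane ∧ v i = k}) ∨
    (∃ i j, i ≠ j ∧ L = {v | v ∈ anglePlane ∧ v i - v j = k})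

/-- Interior of a set of triples relative to the angle plane. -/
def planeInterior (S : Set (Fin 3 → ℝ)) : Set (Fin 3 → ℝ) :=
  {v | v ∈ anglePlane ∧ S ∈ 𝓝[anglePlane] v}

/-- An angle transition matrix: an invertible linear map of `ℝ³` that leaves the angle plane
invariant and preserves re-expression on it. -/
structure IsATM (M : Matrix (Fin 3) (Fin 3) ℝ) : Prop where
  invertible : IsUnit M
  mapsTo : ∀ v ∈ anglePlane, M.mulVec v ∈ anglePlane
  reexpr : ∀ v ∈ anglePlane, ∀ w ∈ anglePlane, Reexpr v w → Reexpr (M.mulVec v) (M.mulVec w)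

/-- `f : D → D` is the linear triangle map with angle transition matrix `M`: the map that `M`
induces on re-expression classes, each class being represented by its point in `D`. -/
def IsLinearTriangleMap (f : D → D) (M : Matrix (Fin 3) (Fin 3) ℝ) : Prop :=
  IsATM M ∧ ∀ v : D, Reexpr (f v).1 (M.mulVec v.1)

/-- The Euclidean angle at `q`, in radians, of the triangle `p q r` in `ℝ³`. -/
noncomputable def angleAt (p q r : Fin 3 → ℝ) : ℝ :=
  EuclideanGeometry.angle (WithLp.toLp 2 p : EuclideanSpace ℝ (Fin 3))
    (WithLp.toLp 2 q) (WithLp.toLp 2 r)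

/-- A finite Markov partition of `X` for `f`: finitely many nonempty regular closed pieces which
cover `X` and have pairwise disjoint interiors, such that `f` is continuous and injective on each
piece and maps each piece onto a union of pieces. -/
structure IsMarkovPartition {X ι : Type*} [TopologicalSpace X] [Finite ι]
    (f : X → X) (P : ι → Set X) : Prop where
  nonempty : ∀ i, (P i).Nonempty
  closure_interior : ∀ i, closure (interior (P i)) = P i
  cover : ⋃ i, P i = Set.univ
  disjoint : ∀ i j, i ≠ j → Disjoint (interior (P i)) (interior (P j))
  continuousOn : ∀ i, ContinuousOn f (P i)
  injOn : ∀ i, Set.InjOn f (P i)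
  markov : ∀ i, ∃ J : Set ι, f '' P i = ⋃ j ∈ J, P j

/-- The one-sided shift on sequences. -/
def shift {α : Type*} (ω : ℕ → α) : ℕ → α := fun k => ω (k + 1)

/-- The Bernoulli measure on sequences of `n` symbols, all symbols having probability `1 / n`. -/
noncomputable def bernoulliMeasure (n : ℕ) : Measure (ℕ → Fin n) :=
  Measure.infinitePi fun _ => ProbabilityTheory.uniformOn Set.univ

/-- Area on `D`, computed in the affine coordinates `(x, y)` of the angle plane (this is
Euclidean area up to a constant factor). -/
noncomputable def area : Measure D :=
  Measure.comap (fun v : D => ((v.1 0, v.1 1) : ℝ × ℝ)) volume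

/-- Normalized Lebesgue measure on `D`. -/
noncomputable def normalizedArea : Measure D := (area Set.univ)⁻¹ • area

/-- Strong mixing of a measure-preserving map of a probability space. -/
structure IsMixing {X : Type*} [MeasurableSpace X] (f : X → X) (μ : Measure X) : Prop where
  measurePreserving : MeasurePreserving f μ μ
  mixing : ∀ s t : Set X, MeasurableSet s → MeasurableSet t →
    Filter.Tendsto (fun n : ℕ => μ (f^[n] ⁻¹' s ∩ t)) Filter.atTop (𝓝 (μ s * μ t))

end TriangleDynamics

namespace TriangleDynamics
open Matrix

/-! On the angle plane re-expression is the orbit relation of `G`: elements of `G` act as `v ↦ ±σv +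
k`, every orbit meets `D` (`exists_mem_D`), and `D` meets each re-expression class at most once
(`Reexpr.eq_of_mem_D`). So for `g ∈ G` and each `v` in the plane, `M g v = h M v` for some `h ∈ G`
depending on `v`. As `G` is countable, one `h` works on a set of positive area, hence everywhere:
`M` conjugates `G` into itself (`IsATM.conjugatesIntoG`).

The geometry follows from this. The conjugate of the reflection in a side of `D` is a nontrivial
element of `G` fixing the `M`-image of that side, while interior points of tiles have trivial
stabilizer. Hence no tile crosses the boundary of `MD`, and `MD` is a union of tiles. The form
`|Mu|²` is invariant under the linear parts of `G`, which forces `M` to be a similarity of the plane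
with ratio `√|det M|`. This gives the angles, and comparing areas counts the tiles.

For the dynamics, `f` maps each piece onto all of `D`, with inverse branches `M⁻¹ gᵢ` contracting
Euclidean distance by `1/√n`. Composing branches along words yields the coding map. Averages of a
continuous function over words converge uniformly to its integral against any branch-invariant
probability measure. So that measure is unique, which identifies the image of the Bernoulli measure
with normalized area, and mixing follows by duality. -/

/-! ### The form of the elements of `G` on the angle plane. -/

/-- The matrices of `G` act on the angle plane as integral translates of signed permutations. -/
def IsCrystallographic (g : Matrix (Fin 3) (Fin 3) ℝ) : Prop :=
  ∃ (s : ℝ) (σ : Equiv.Perm (Fin 3)) (k : Fin 3 → ℤ), (s = 1 ∨ s = -1) ∧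
    ∀ v ∈ anglePlane, ∀ i, (g *ᵥ v) i = s * v (σ i) + k i

/-- The matrix leaves every plane `x + y + z = c` invariant. -/
def PreservesSum (K : Matrix (Fin 3) (Fin 3) ℝ) : Prop :=
  ∀ v : Fin 3 → ℝ, (K *ᵥ v) 0 + (K *ᵥ v) 1 + (K *ᵥ v) 2 = v 0 + v 1 + v 2

lemma PreservesSum.mem {K : Matrix (Fin 3) (Fin 3) ℝ} (h : PreservesSum K) {v : Fin 3 → ℝ}
    (hv : v ∈ anglePlane) : K *ᵥ v ∈ anglePlane := (h v).trans hv

lemma PreservesSum.mul {K L : Matrix (Fin 3) (Fin 3) ℝ} (h : PreservesSum K)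
    (h' : PreservesSum L) : PreservesSum (K * L) := fun v => by
  rw [← mulVec_mulVec, h, h']

lemma GL_inv_mulVec (g : GL (Fin 3) ℝ) (v : Fin 3 → ℝ) : g⁻¹.1 *ᵥ (g.1 *ᵥ v) = v := by
  rw [mulVec_mulVec, ← Units.val_mul]; simp

lemma GL_mulVec_inv (g : GL (Fin 3) ℝ) (v : Fin 3 → ℝ) : g.1 *ᵥ (g⁻¹.1 *ᵥ v) = v := by
  rw [mulVec_mulVec, ← Units.val_mul]; simp

lemma GL_mul_mulVec (g h : GL (Fin 3) ℝ) (v : Fin 3 → ℝ) :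
    (g * h).1 *ᵥ v = g.1 *ᵥ (h.1 *ᵥ v) := by
  rw [mulVec_mulVec, ← Units.val_mul]

lemma PreservesSum.inv {g : GL (Fin 3) ℝ} (h : PreservesSum g.1) : PreservesSum g⁻¹.1 :=
  fun v => by rw [← h, GL_mulVec_inv]

lemma mem_anglePlane {v : Fin 3 → ℝ} : v ∈ anglePlane ↔ v 0 + v 1 + v 2 = 1 := Iff.rfl

/-- The basis vectors lie on the plane, so its invariance makes every column sum 1. -/
lemma preservesSum_of_mapsTo {K : Matrix (Fin 3) (Fin 3) ℝ}
    (h : ∀ v ∈ anglePlane, K *ᵥ v ∈ anglePlane) : PreservesSum K := by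
  intro v
  have h0 := h ![1, 0, 0] (by simp [anglePlane])
  have h1 := h ![0, 1, 0] (by simp [anglePlane])
  have h2 := h ![0, 0, 1] (by simp [anglePlane])
  simp only [anglePlane, Set.mem_ofPred_eq, mulVec, dotProduct, Fin.sum_univ_three, cons_val_zero,
    cons_val_one, cons_val, mul_one, mul_zero, add_zero, zero_add] at h0 h1 h2 ⊢
  linear_combination v 0 * h0 + v 1 * h1 + v 2 * h2

lemma P13_mulVec (v : Fin 3 → ℝ) : P13 *ᵥ v = ![v 2, v 1, v 0] := by
  ext i; fin_cases i <;> simp [P13, mulVec, dotProduct, Fin.sum_univ_three]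

lemma P23_mulVec (v : Fin 3 → ℝ) : P23 *ᵥ v = ![v 0, v 2, v 1] := by
  ext i; fin_cases i <;> simp [P23, mulVec, dotProduct, Fin.sum_univ_three]

lemma Rz_mulVec (v : Fin 3 → ℝ) : Rz *ᵥ v = ![v 0 + v 2, v 1 + v 2, -v 2] := by
  ext i; fin_cases i <;> simp [Rz, mulVec, dotProduct, Fin.sum_univ_three]

lemma ext_mulVec {K L : Matrix (Fin 3) (Fin 3) ℝ} (h : ∀ v, K *ᵥ v = L *ᵥ v) : K = L :=
  Matrix.ext_of_mulVec_single fun _ => h _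

/-- `P13` as an invertible matrix. -/
def p13 : GL (Fin 3) ℝ :=
  ⟨P13, P13, ext_mulVec fun v => by ext i; rw [← mulVec_mulVec]; fin_cases i <;> simp [P13_mulVec],
    ext_mulVec fun v => by ext i; rw [← mulVec_mulVec]; fin_cases i <;> simp [P13_mulVec]⟩

/-- `P23` as an invertible matrix. -/
def p23 : GL (Fin 3) ℝ :=
  ⟨P23, P23, ext_mulVec fun v => by ext i; rw [← mulVec_mulVec]; fin_cases i <;> simp [P23_mulVec],
    ext_mulVec fun v => by ext i; rw [← mulVec_mulVec]; fin_cases i <;> simp [P23_mulVec]⟩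

/-- `Rz` as an invertible matrix. -/
def rz : GL (Fin 3) ℝ :=
  ⟨Rz, Rz, ext_mulVec fun v => by ext i; rw [← mulVec_mulVec]; fin_cases i <;> simp [Rz_mulVec],
    ext_mulVec fun v => by ext i; rw [← mulVec_mulVec]; fin_cases i <;> simp [Rz_mulVec]⟩

lemma p13_mulVec (v : Fin 3 → ℝ) : p13.1 *ᵥ v = ![v 2, v 1, v 0] := P13_mulVec v
lemma p23_mulVec (v : Fin 3 → ℝ) : p23.1 *ᵥ v = ![v 0, v 2, v 1] := P23_mulVec v
lemma rz_mulVec (v : Fin 3 → ℝ) : rz.1 *ᵥ v = ![v 0 + v 2, v 1 + v 2, -v 2] := Rz_mulVec v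

lemma p13_mem : p13 ∈ G := Subgroup.subset_closure (by simp [p13])
lemma p23_mem : p23 ∈ G := Subgroup.subset_closure (by simp [p23])
lemma rz_mem : rz ∈ G := Subgroup.subset_closure (by simp [rz])

lemma preservesSum_of_mem {g : GL (Fin 3) ℝ} (hg : g ∈ G) :
    PreservesSum g.1 := by
  induction hg using Subgroup.closure_induction with
  | mem x hx =>
    rcases hx with hx | hx | hx <;> intro v <;> rw [hx]
    · simp only [P13_mulVec, cons_val_zero, cons_val_one, cons_val]; ring
    · simp only [P23_mulVec, cons_val_zero, cons_val_one, cons_val]; ring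
    · simp only [Rz_mulVec, cons_val_zero, cons_val_one, cons_val]; ring
  | one => intro v; simp
  | mul x y _ _ hx hy => exact hx.mul hy
  | inv x _ hx => exact hx.inv

lemma isCrystallographic_of_mem {g : GL (Fin 3) ℝ} (hg : g ∈ G) : IsCrystallographic g.1 := by
  have hgG := hg
  rw [G] at hgG
  induction hgG using Subgroup.closure_induction with
  | mem x hx =>
    rcases hx with hx | hx | hx
    · refine ⟨1, Equiv.swap 0 2, 0, Or.inl rfl, fun v hv i => ?_⟩
      rw [hx, P13_mulVec]
      fin_cases i <;> simp [Equiv.swap_apply_of_ne_of_ne]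
    · refine ⟨1, Equiv.swap 1 2, 0, Or.inl rfl, fun v hv i => ?_⟩
      rw [hx, P23_mulVec]
      fin_cases i <;> simp [Equiv.swap_apply_of_ne_of_ne]
    -- On the plane `x + z = 1 - y` and `y + z = 1 - x`.
    · refine ⟨-1, Equiv.swap 0 1, ![1, 1, 0], Or.inr rfl, fun v hv i => ?_⟩
      rw [hx, Rz_mulVec]
      rw [mem_anglePlane] at hv
      fin_cases i <;> simp [Equiv.swap_apply_of_ne_of_ne] <;> linarith
  | one => exact ⟨1, 1, 0, Or.inl rfl, fun v hv i => by simp⟩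
  | mul x y hx' hy' hx hy =>
    obtain ⟨s, σ, k, hs, h⟩ := hx hx'
    obtain ⟨s', σ', k', hs', h'⟩ := hy hy'
    rcases hs with rfl | rfl
    · refine ⟨s', σ.trans σ', fun i => k' (σ i) + k i, hs', fun v hv i => ?_⟩
      rw [GL_mul_mulVec, h _ ((preservesSum_of_mem hy').mem hv), h' v hv]
      push_cast; simp; ring
    · refine ⟨-s', σ.trans σ', fun i => -k' (σ i) + k i, ?_, fun v hv i => ?_⟩
      · rcases hs' with rfl | rfl <;> simp
      rw [GL_mul_mulVec, h _ ((preservesSum_of_mem hy').mem hv), h' v hv]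
      push_cast; simp; ring
  | inv x hx' hx =>
    obtain ⟨s, σ, k, hs, h⟩ := hx hx'
    have hss : s * s = 1 := by rcases hs with rfl | rfl <;> simp
    have key : ∀ v ∈ anglePlane, ∀ i,
        (x⁻¹.1 *ᵥ v) i = s * (v (σ.symm i) - k (σ.symm i)) := by
      intro v hv i
      have := h (x⁻¹.1 *ᵥ v) ((preservesSum_of_mem (G.inv_mem hx')).mem hv) (σ.symm i)
      rw [GL_mulVec_inv, Equiv.apply_symm_apply] at this
      rw [this]; linear_combination -(x⁻¹.1 *ᵥ v) i * hss
    rcases hs with rfl | rfl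
    · exact ⟨1, σ.symm, fun i => -k (σ.symm i), Or.inl rfl, fun v hv i => by
        rw [key v hv]; push_cast; ring⟩
    · exact ⟨-1, σ.symm, fun i => k (σ.symm i), Or.inr rfl, fun v hv i => by
        rw [key v hv]; ring⟩

/-! ### Re-expression classes, `G`-orbits and the fundamental domain. -/

lemma Reexpr.of_isCrystallographic {g : Matrix (Fin 3) (Fin 3) ℝ} (h : IsCrystallographic g)
    {v : Fin 3 → ℝ} (hv : v ∈ anglePlane) : Reexpr (g *ᵥ v) v := by
  obtain ⟨s, σ, k, rfl | rfl, h⟩ := h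
  · exact ⟨σ, Or.inl fun i => ⟨k i, by rw [h v hv]; ring⟩⟩
  · exact ⟨σ, Or.inr fun i => ⟨k i, by rw [h v hv]; ring⟩⟩

lemma Reexpr.of_mem {g : GL (Fin 3) ℝ} (hg : g ∈ G)
    {v : Fin 3 → ℝ} (hv : v ∈ anglePlane) : Reexpr (g.1 *ᵥ v) v :=
  .of_isCrystallographic (isCrystallographic_of_mem hg) hv

lemma Reexpr.symm {v w : Fin 3 → ℝ} (h : Reexpr v w) : Reexpr w v := by
  obtain ⟨σ, h | h⟩ := h
  · refine ⟨σ.symm, Or.inl fun i => ?_⟩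
    obtain ⟨k, hk⟩ := h (σ.symm i)
    exact ⟨-k, by rw [hk]; simp⟩
  · refine ⟨σ.symm, Or.inr fun i => ?_⟩
    obtain ⟨k, hk⟩ := h (σ.symm i)
    exact ⟨k, by rw [hk]; simp⟩

lemma Reexpr.trans {u v w : Fin 3 → ℝ} (h : Reexpr u v) (h' : Reexpr v w) : Reexpr u w := by
  obtain ⟨σ, h | h⟩ := h <;> obtain ⟨τ, h' | h'⟩ := h'
  · refine ⟨σ.trans τ, Or.inl fun i => ?_⟩
    obtain ⟨k, hk⟩ := h i
    obtain ⟨l, hl⟩ := h' (σ i)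
    exact ⟨l + k, by rw [hk, hl]; push_cast; simp; ring⟩
  · refine ⟨σ.trans τ, Or.inr fun i => ?_⟩
    obtain ⟨k, hk⟩ := h i
    obtain ⟨l, hl⟩ := h' (σ i)
    exact ⟨l + k, by rw [hk, hl]; push_cast; simp; ring⟩
  · refine ⟨σ.trans τ, Or.inr fun i => ?_⟩
    obtain ⟨k, hk⟩ := h i
    obtain ⟨l, hl⟩ := h' (σ i)
    exact ⟨-l + k, by rw [hk, hl]; push_cast; simp; ring⟩
  · refine ⟨σ.trans τ, Or.inl fun i => ?_⟩
    obtain ⟨k, hk⟩ := h i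
    obtain ⟨l, hl⟩ := h' (σ i)
    exact ⟨-l + k, by rw [hk, hl]; push_cast; simp; ring⟩

/-- The point reflection `(x, y, z) ↦ (1 - x, 1 - y, -z)` of the angle plane. -/
def pointReflection₃ : GL (Fin 3) ℝ := rz * (p13 * p23 * p13)

lemma pointReflection₃_mem : pointReflection₃ ∈ G :=
  G.mul_mem rz_mem (G.mul_mem (G.mul_mem p13_mem p23_mem) p13_mem)

lemma pointReflection₃_mulVec {v : Fin 3 → ℝ} (hv : v ∈ anglePlane) :
    pointReflection₃.1 *ᵥ v = ![1 - v 0, 1 - v 1, - v 2] := by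
  rw [mem_anglePlane] at hv
  simp only [pointReflection₃, GL_mul_mulVec, p13_mulVec, p23_mulVec, rz_mulVec]
  ext i; fin_cases i <;> simp <;> linarith

/-- The translation by `(1, 0, -1)`. -/
def translation₁₃ : GL (Fin 3) ℝ := pointReflection₃ * (p13 * pointReflection₃ * p13)

lemma translation₁₃_mem : translation₁₃ ∈ G :=
  G.mul_mem pointReflection₃_mem (G.mul_mem (G.mul_mem p13_mem pointReflection₃_mem) p13_mem)

/-- Two half turns compose to the translation by twice the vector between their centres, here `(1/2,
1/2, 0)` and `(0, 1/2, 1/2)`. -/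
lemma translation₁₃_mulVec {v : Fin 3 → ℝ} (hv : v ∈ anglePlane) :
    translation₁₃.1 *ᵥ v = ![v 0 + 1, v 1, v 2 - 1] := by
  have h1 : p13.1 *ᵥ v ∈ anglePlane := (preservesSum_of_mem p13_mem).mem hv
  have h2 := (preservesSum_of_mem p13_mem).mem ((preservesSum_of_mem pointReflection₃_mem).mem h1)
  rw [translation₁₃, GL_mul_mulVec, GL_mul_mulVec, GL_mul_mulVec, pointReflection₃_mulVec h2,
    pointReflection₃_mulVec h1]
  simp only [p13_mulVec]
  ext i; fin_cases i <;> simp; ring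

lemma exists_mem_translation (n : ℤ) : ∃ g ∈ G, ∀ v ∈ anglePlane,
    g.1 *ᵥ v = ![v 0 + n, v 1, v 2 - n] := by
  refine ⟨translation₁₃ ^ n, G.zpow_mem translation₁₃_mem n, ?_⟩
  induction n using Int.induction_on with
  | zero => intro v hv; ext i; fin_cases i <;> simp
  | succ n ih =>
    intro v hv
    rw [_root_.zpow_add_one, GL_mul_mulVec,
      ih _ ((preservesSum_of_mem translation₁₃_mem).mem hv), translation₁₃_mulVec hv]
    ext i; fin_cases i <;> simp <;> ring
  | pred n ih =>
    intro v hv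
    have hv' := (preservesSum_of_mem (G.inv_mem translation₁₃_mem)).mem hv
    rw [_root_.zpow_sub_one, GL_mul_mulVec, ih _ hv']
    have := translation₁₃_mulVec hv'
    rw [GL_mulVec_inv] at this
    have h0 := congrFun this 0
    have h1 := congrFun this 1
    have h2 := congrFun this 2
    simp only [cons_val_zero, cons_val_one, cons_val] at h0 h1 h2
    ext i; fin_cases i <;> simp only [Fin.zero_eta, Fin.mk_one, Fin.reduceFinMk, cons_val_zero,
      cons_val_one, cons_val, Int.cast_sub, Int.cast_one] <;> linarith

lemma mem_D {v : Fin 3 → ℝ} :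
    v ∈ D ↔ v 0 + v 1 + v 2 = 1 ∧ v 1 ≤ v 0 ∧ v 2 ≤ v 1 ∧ 0 ≤ v 2 := Iff.rfl

lemma exists_mem_D_of_nonneg {v : Fin 3 → ℝ} (hv : v ∈ anglePlane) (h : ∀ i, 0 ≤ v i) :
    ∃ g ∈ G, g.1 *ᵥ v ∈ D := by
  have h0 := h 0
  have h1 := h 1
  have h2 := h 2
  rw [mem_anglePlane] at hv
  have e := p13_mem
  have e' := p23_mem
  have aux : ∀ {a b c : ℝ} {g : GL (Fin 3) ℝ}, g ∈ G → g.1 *ᵥ v = ![a, b, c] →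
      a + b + c = 1 → b ≤ a → c ≤ b → 0 ≤ c → ∃ g ∈ G, g.1 *ᵥ v ∈ D :=
    fun {a b c g} hg hgv h1 h2 h3 h4 => ⟨g, hg, by
      rw [hgv]
      exact ⟨by simpa [anglePlane] using h1, by simpa using h2, by simpa using h3,
        by simpa using h4⟩⟩
  rcases le_total (v 0) (v 1) with h01 | h01 <;> rcases le_total (v 1) (v 2) with h12 | h12
  · exact aux e (p13_mulVec v) (by linarith) (by linarith) (by linarith) (by linarith)
  · rcases le_total (v 0) (v 2) with h02 | h02
    · exact aux (g := p13 * p23) (a := v 1) (b := v 2) (c := v 0) (G.mul_mem e e')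
        (by simp only [GL_mul_mulVec, p13_mulVec, p23_mulVec, cons_val_zero, cons_val_one, cons_val])
        (by linarith) (by linarith) (by linarith) (by linarith)
    · exact aux (g := p13 * p23 * p13) (a := v 1) (b := v 0) (c := v 2)
        (G.mul_mem (G.mul_mem e e') e)
        (by simp only [GL_mul_mulVec, p13_mulVec, p23_mulVec, cons_val_zero, cons_val_one, cons_val])
        (by linarith) (by linarith) (by linarith) (by linarith)
  · rcases le_total (v 0) (v 2) with h02 | h02
    · exact aux (g := p23 * p13) (a := v 2) (b := v 0) (c := v 1) (G.mul_mem e' e)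
        (by simp only [GL_mul_mulVec, p13_mulVec, p23_mulVec, cons_val_zero, cons_val_one, cons_val])
        (by linarith) (by linarith) (by linarith) (by linarith)
    · exact aux e' (p23_mulVec v) (by linarith) (by linarith) (by linarith) (by linarith)
  · exact aux (g := 1) (a := v 0) (b := v 1) (c := v 2) G.one_mem
      (by ext i; fin_cases i <;> simp) hv h01 h12 h2

/-- Every orbit of `G` on the angle plane meets `D`. -/
theorem exists_mem_D {v : Fin 3 → ℝ} (hv : v ∈ anglePlane) : ∃ g ∈ G, g.1 *ᵥ v ∈ D := by
  have step : ∀ {w : Fin 3 → ℝ} {g : GL (Fin 3) ℝ}, g ∈ G → g.1 *ᵥ v = w →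
      (∃ g ∈ G, g.1 *ᵥ w ∈ D) → ∃ g ∈ G, g.1 *ᵥ v ∈ D := by
    rintro w g hg rfl ⟨g', hg', h⟩
    exact ⟨g' * g, G.mul_mem hg' hg, by rwa [GL_mul_mulVec]⟩
  obtain ⟨a, ha, ha'⟩ := exists_mem_translation (-⌊v 0⌋)
  obtain ⟨b, hb, hb'⟩ := exists_mem_translation (-⌊v 1⌋)
  have he : p13 * p23 * p13 ∈ G := G.mul_mem (G.mul_mem p13_mem p23_mem) p13_mem
  have he' : ∀ w, (p13 * p23 * p13).1 *ᵥ w = ![w 1, w 0, w 2] := fun w => by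
    simp only [GL_mul_mulVec, p13_mulVec, p23_mulVec, cons_val_zero, cons_val_one, cons_val]
  have hv' := hv
  rw [mem_anglePlane] at hv'
  -- Translations along `(1, 0, -1)` and, conjugating by the swap of the first two coordinates,
  -- along `(0, 1, -1)` reduce those coordinates modulo 1.
  set w : Fin 3 → ℝ := ![Int.fract (v 0), Int.fract (v 1), 1 - Int.fract (v 0) - Int.fract (v 1)]
    with hw
  have hwA : w ∈ anglePlane := by simp [mem_anglePlane, hw]
  have f0 := Int.fract_nonneg (v 0)
  have f1 := Int.fract_nonneg (v 1)
  have l0 := (Int.fract_lt_one (v 0)).le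
  have l1 := (Int.fract_lt_one (v 1)).le
  refine step (w := w) (g := p13 * p23 * p13 * b * (p13 * p23 * p13) * a)
    (G.mul_mem (G.mul_mem (G.mul_mem he hb) he) ha) ?_ ?_
  · rw [GL_mul_mulVec, GL_mul_mulVec, GL_mul_mulVec, ha' v hv, he', hb' _ ?_, he']
    · ext i; fin_cases i <;> simp [hw] <;>
        linarith [Int.self_sub_floor (v 0), Int.self_sub_floor (v 1)]
    · rw [he']; simp [mem_anglePlane]; linarith
  -- If the third coordinate is negative, the half turn about `(1/2, 1/2, 0)` makes all three
  -- nonnegative.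
  rcases le_total 0 (w 2) with h2 | h2
  · refine exists_mem_D_of_nonneg hwA fun i => ?_
    fin_cases i
    · simp [hw]
    · simp [hw]
    · exact h2
  · obtain ⟨g, hg, h⟩ := exists_mem_D_of_nonneg
      ((preservesSum_of_mem pointReflection₃_mem).mem hwA) (fun i => by
        rw [pointReflection₃_mulVec hwA]
        fin_cases i
        · simpa [hw] using l0
        · simpa [hw] using l1
        · simpa using h2)
    exact ⟨g * pointReflection₃, G.mul_mem hg pointReflection₃_mem, by rwa [GL_mul_mulVec]⟩

lemma apply_le_one_of_mem_D {v : Fin 3 → ℝ} (hv : v ∈ D) (i : Fin 3) : 0 ≤ v i ∧ v i ≤ 1 := by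
  obtain ⟨hv, h1, h2, h3⟩ := mem_D.1 hv
  fin_cases i <;> constructor <;> simp <;> linarith

/-- Coordinates in `[0, 1]` leave only the integer shifts -1, 0, 1, and the third shift is
determined by the other two, so finitely many cases remain. -/
lemma eq_of_mem_D_of_add {v w : Fin 3 → ℝ} (hv : v ∈ D) (hw : w ∈ D) (σ : Equiv.Perm (Fin 3))
    (h : ∀ i, ∃ k : ℤ, v i = w (σ i) + k) : v = w := by
  have key : ∀ i, ∃ k : ℤ, v i = w (σ i) + k ∧ -1 ≤ k ∧ k ≤ 1 := by
    intro i
    obtain ⟨k, hk⟩ := h i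
    have h1 := apply_le_one_of_mem_D hv i
    have h2 := apply_le_one_of_mem_D hw (σ i)
    refine ⟨k, hk, ?_, ?_⟩ <;> rify <;> linarith
  obtain ⟨k, hk, ka, kb⟩ := key 0
  obtain ⟨l, hl, la, lb⟩ := key 1
  obtain ⟨m, hm, -, -⟩ := key 2
  have n01 : σ 0 ≠ σ 1 := σ.injective.ne (by decide)
  have n02 : σ 0 ≠ σ 2 := σ.injective.ne (by decide)
  have n12 : σ 1 ≠ σ 2 := σ.injective.ne (by decide)
  obtain ⟨hv, v1, v2, v3⟩ := mem_D.1 hv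
  obtain ⟨hw, w1, w2, w3⟩ := mem_D.1 hw
  suffices v 0 = w 0 ∧ v 1 = w 1 by
    ext i; fin_cases i
    exacts [this.1, this.2, by simp only [Fin.reduceFinMk]; linarith [this.1, this.2]]
  have hσ : w (σ 0) + w (σ 1) + w (σ 2) = 1 := by
    generalize σ 0 = a at *
    generalize σ 1 = b at *
    generalize σ 2 = c at *
    fin_cases a <;> fin_cases b <;> fin_cases c <;> first | contradiction | (simp; linarith)
  have hkm : (m : ℝ) = -k - l := by linarith
  rw [hkm] at hm
  clear hkm key h hσ
  generalize σ 0 = a at *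
  generalize σ 1 = b at *
  generalize σ 2 = c at *
  fin_cases a <;> fin_cases b <;> fin_cases c <;> first | contradiction | skip
  all_goals
    simp only [Fin.zero_eta, Fin.mk_one, Fin.reduceFinMk] at hk hl hm
    interval_cases k <;> interval_cases l <;> push_cast at hk hl hm <;> constructor <;> linarith

lemma eq_of_mem_D_of_neg {v w : Fin 3 → ℝ} (hv : v ∈ D) (hw : w ∈ D) (σ : Equiv.Perm (Fin 3))
    (h : ∀ i, ∃ k : ℤ, v i = -w (σ i) + k) : v = w := by
  have key : ∀ i, ∃ k : ℤ, v i = -w (σ i) + k ∧ 0 ≤ k ∧ k ≤ 2 := by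
    intro i
    obtain ⟨k, hk⟩ := h i
    have h1 := apply_le_one_of_mem_D hv i
    have h2 := apply_le_one_of_mem_D hw (σ i)
    refine ⟨k, hk, ?_, ?_⟩ <;> rify <;> linarith
  obtain ⟨k, hk, ka, kb⟩ := key 0
  obtain ⟨l, hl, la, lb⟩ := key 1
  obtain ⟨m, hm, -, -⟩ := key 2
  have n01 : σ 0 ≠ σ 1 := σ.injective.ne (by decide)
  have n02 : σ 0 ≠ σ 2 := σ.injective.ne (by decide)
  have n12 : σ 1 ≠ σ 2 := σ.injective.ne (by decide)
  obtain ⟨hv, v1, v2, v3⟩ := mem_D.1 hv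
  obtain ⟨hw, w1, w2, w3⟩ := mem_D.1 hw
  suffices v 0 = w 0 ∧ v 1 = w 1 by
    ext i; fin_cases i
    exacts [this.1, this.2, by simp only [Fin.reduceFinMk]; linarith [this.1, this.2]]
  have hσ : w (σ 0) + w (σ 1) + w (σ 2) = 1 := by
    generalize σ 0 = a at *
    generalize σ 1 = b at *
    generalize σ 2 = c at *
    fin_cases a <;> fin_cases b <;> fin_cases c <;> first | contradiction | (simp; linarith)
  -- Both triples sum to 1, so the three integers `v i + w (σ i)` sum to 2.
  have hkm : (m : ℝ) = 2 - k - l := by linarith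
  rw [hkm] at hm
  clear hkm key h hσ
  generalize σ 0 = a at *
  generalize σ 1 = b at *
  generalize σ 2 = c at *
  fin_cases a <;> fin_cases b <;> fin_cases c <;> first | contradiction | skip
  all_goals
    simp only [Fin.zero_eta, Fin.mk_one, Fin.reduceFinMk] at hk hl hm
    interval_cases k <;> interval_cases l <;> push_cast at hk hl hm <;> constructor <;> linarith

/-- `D` meets every re-expression class at most once. -/
theorem Reexpr.eq_of_mem_D {v w : Fin 3 → ℝ} (h : Reexpr v w) (hv : v ∈ D) (hw : w ∈ D) :
    v = w := by
  obtain ⟨σ, h | h⟩ := h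
  · exact eq_of_mem_D_of_add hv hw σ h
  · exact eq_of_mem_D_of_neg hv hw σ h

/-- The converse of `Reexpr.of_mem`. No word in the generators is needed: both points are moved into
`D`, where they must coincide. -/
theorem Reexpr.exists_mem {v w : Fin 3 → ℝ} (h : Reexpr v w) (hv : v ∈ anglePlane)
    (hw : w ∈ anglePlane) : ∃ g ∈ G, v = g.1 *ᵥ w := by
  obtain ⟨a, ha, hav⟩ := exists_mem_D hv
  obtain ⟨b, hb, hbw⟩ := exists_mem_D hw
  have := ((Reexpr.of_mem ha hv).trans (h.trans (Reexpr.of_mem hb hw).symm)).eq_of_mem_D hav hbw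
  refine ⟨a⁻¹ * b, G.mul_mem (G.inv_mem ha) hb, ?_⟩
  rw [GL_mul_mulVec, ← this, GL_inv_mulVec]

/-! ### Rigidity of `G`, the sides and the interior of `D`. -/

lemma convex_anglePlane : Convex ℝ anglePlane := by
  intro x hx y hy a b _ _ hab
  rw [mem_anglePlane] at *
  simp only [Pi.add_apply, Pi.smul_apply, smul_eq_mul]
  linear_combination a * hx + b * hy + hab

lemma eq_of_eqOn_anglePlane {K L : Matrix (Fin 3) (Fin 3) ℝ}
    (h : ∀ v ∈ anglePlane, K *ᵥ v = L *ᵥ v) : K = L :=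
  Matrix.ext_of_mulVec_single fun i => h _ (by fin_cases i <;> simp [mem_anglePlane])

lemma GL_eq_one {g : GL (Fin 3) ℝ} (h : ∀ v ∈ anglePlane, g.1 *ᵥ v = v) : g = 1 :=
  Units.ext (eq_of_eqOn_anglePlane fun v hv => by rw [h v hv]; simp)

/-- A small step from `v` towards any `u` in the plane stays in `S`, so by linearity `u` is fixed
too; the plane spans the space. -/
lemma eq_one_of_fixes_nhdsWithin {g : GL (Fin 3) ℝ} {S : Set (Fin 3 → ℝ)} {v : Fin 3 → ℝ}
    (hv : v ∈ anglePlane) (hS : S ∈ 𝓝[anglePlane] v) (h : ∀ w ∈ S, g.1 *ᵥ w = w) : g = 1 := by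
  refine GL_eq_one fun u hu => ?_
  have hgv : g.1 *ᵥ v = v := h v (mem_of_mem_nhdsWithin hv hS)
  have hA : ∀ t : ℝ, v + t • (u - v) ∈ anglePlane := fun t => by
    rw [mem_anglePlane] at *
    simp only [Pi.add_apply, Pi.smul_apply, Pi.sub_apply, smul_eq_mul]
    linear_combination hv + t * (hu - hv)
  have ht : Filter.Tendsto (fun t : ℝ => v + t • (u - v)) (𝓝[≠] 0) (𝓝[anglePlane] v) := by
    refine tendsto_nhdsWithin_iff.2 ⟨?_, Filter.Eventually.of_forall hA⟩
    have : Filter.Tendsto (fun t : ℝ => v + t • (u - v)) (𝓝 0) (𝓝 (v + (0 : ℝ) • (u - v))) :=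
      (by fun_prop : Continuous fun t : ℝ => v + t • (u - v)).tendsto 0
    rw [zero_smul, add_zero] at this
    exact this.mono_left nhdsWithin_le_nhds
  obtain ⟨t, htS, ht0⟩ := ((ht.eventually hS).and self_mem_nhdsWithin).exists
  have h1 := h _ htS
  rw [mulVec_add, mulVec_smul, mulVec_sub, hgv] at h1
  have h2 := smul_right_injective _ (show t ≠ 0 from ht0) (add_left_cancel h1)
  exact sub_left_injective h2

/-- The linear functionals defining the three sides of `D`. -/
def side : Fin 3 → (Fin 3 → ℝ) →ₗ[ℝ] ℝ :=
  ![.proj (φ := fun _ => ℝ) 0 - .proj 1, .proj (φ := fun _ => ℝ) 1 - .proj 2, .proj 2]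

lemma mem_D_iff_side {v : Fin 3 → ℝ} : v ∈ D ↔ v ∈ anglePlane ∧ ∀ j, 0 ≤ side j v := by
  rw [mem_D, mem_anglePlane]
  simp [side, Fin.forall_fin_succ]

lemma continuous_side (j : Fin 3) : Continuous (side j) := (side j).continuous_of_finiteDimensional

/-- The interior of `D` in the angle plane. -/
def openD : Set (Fin 3 → ℝ) := {v | v ∈ anglePlane ∧ ∀ j, 0 < side j v}

lemma openD_subset : openD ⊆ D := fun _ hv => mem_D_iff_side.2 ⟨hv.1, fun j => (hv.2 j).le⟩

lemma setOf_side_mem_nhdsWithin {v : Fin 3 → ℝ} (hv : ∀ j, 0 < side j v) :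
    {w | w ∈ anglePlane ∧ ∀ j, 0 < side j w} ∈ 𝓝[anglePlane] v := by
  refine Filter.inter_mem self_mem_nhdsWithin (mem_nhdsWithin_of_mem_nhds ?_)
  exact Filter.eventually_all.2 fun j => (continuous_side j).continuousAt.eventually
    (lt_mem_nhds (hv j))

lemma openD_mem_nhdsWithin {v : Fin 3 → ℝ} (hv : v ∈ openD) : openD ∈ 𝓝[anglePlane] v :=
  setOf_side_mem_nhdsWithin hv.2

/-- A point in the interior of `D`. -/
noncomputable def center : Fin 3 → ℝ := ![1 / 2, 1 / 3, 1 / 6]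

lemma center_mem : center ∈ openD := by
  refine ⟨?_, fun j => ?_⟩
  · rw [mem_anglePlane]; simp only [center, cons_val_zero, cons_val_one, cons_val]; norm_num
  · fin_cases j <;> simp [center, side] <;> norm_num

lemma segment_mem_openD {v : Fin 3 → ℝ} (hv : v ∈ D) {t : ℝ} (ht : 0 < t) (ht' : t ≤ 1) :
    (1 - t) • v + t • center ∈ openD := by
  obtain ⟨hA, h⟩ := mem_D_iff_side.1 hv
  refine ⟨convex_anglePlane hA center_mem.1 (by linarith) ht.le (by ring), fun j => ?_⟩
  rw [map_add, map_smul, map_smul]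
  exact add_pos_of_nonneg_of_pos (mul_nonneg (by linarith) (h j)) (mul_pos ht (center_mem.2 j))

lemma tendsto_segment (v c : Fin 3 → ℝ) :
    Filter.Tendsto (fun t : ℝ => (1 - t) • v + t • c) (𝓝[>] 0) (𝓝 v) := by
  have : Filter.Tendsto (fun t : ℝ => (1 - t) • v + t • c) (𝓝 0)
      (𝓝 ((1 - (0 : ℝ)) • v + (0 : ℝ) • c)) :=
    (by fun_prop : Continuous fun t : ℝ => (1 - t) • v + t • c).tendsto 0
  rw [zero_smul, sub_zero, one_smul, add_zero] at this
  exact this.mono_left nhdsWithin_le_nhds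

lemma D_subset_closure_openD : D ⊆ closure openD := by
  intro v hv
  refine mem_closure_of_tendsto (tendsto_segment v center) ?_
  filter_upwards [Ioo_mem_nhdsGT (zero_lt_one' ℝ)] with t ht
  exact segment_mem_openD hv ht.1 ht.2.le

/-- By convexity, a linear form without zeros in the interior cannot change sign on `D`. -/
lemma nonneg_on_D {β : (Fin 3 → ℝ) →ₗ[ℝ] ℝ} (h0 : ∀ x ∈ openD, β x ≠ 0) {p : Fin 3 → ℝ}
    (hp : p ∈ D) (hβ : 0 < β p) {y : Fin 3 → ℝ} (hy : y ∈ D) : 0 ≤ β y := by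
  have key : ∀ z ∈ D, 0 ≤ β z * β center := by
    intro z hz
    by_contra! hneg
    have hne : β center - β z ≠ 0 := fun h => by
      rw [sub_eq_zero] at h; rw [h] at hneg; exact absurd hneg (not_lt.2 (mul_self_nonneg _))
    -- This parameter is the zero of `β` on the segment from `z` to `center`.
    have ht : 0 < -β z / (β center - β z) ∧ -β z / (β center - β z) ≤ 1 := by
      rcases mul_neg_iff.1 hneg with ⟨h1, h2⟩ | ⟨h1, h2⟩
      · have : β center - β z < 0 := by linarith
        exact ⟨div_pos_of_neg_of_neg (by linarith) this, (div_le_one_of_neg this).2 (by linarith)⟩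
      · have : 0 < β center - β z := by linarith
        exact ⟨div_pos (by linarith) this, (div_le_one this).2 (by linarith)⟩
    refine h0 _ (segment_mem_openD hz ht.1 ht.2) ?_
    rw [map_add, map_smul, map_smul, smul_eq_mul, smul_eq_mul]
    field_simp
    ring
  have hc : 0 < β center := by
    have h1 := key p hp
    have h2 := h0 _ center_mem
    by_contra! hneg
    nlinarith [lt_of_le_of_ne hneg h2]
  exact nonneg_of_mul_nonneg_left (key y hy) hc

/-- `D` meets every orbit of `G` at most once. -/
lemma eq_of_mem_D_of_mulVec {g h : GL (Fin 3) ℝ} (hg : g ∈ G) (hh : h ∈ G) {x y : Fin 3 → ℝ}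
    (hx : x ∈ D) (hy : y ∈ D) (h' : g.1 *ᵥ x = h.1 *ᵥ y) : x = y :=
  ((Reexpr.of_mem hg hx.1).symm.trans (h' ▸ Reexpr.of_mem hh hy.1)).eq_of_mem_D hx hy

/-- The points in the interior of `D` have trivial stabilizer. -/
lemma eq_one_of_fixes_openD {g : GL (Fin 3) ℝ} (hg : g ∈ G) {x : Fin 3 → ℝ} (hx : x ∈ openD)
    (h : g.1 *ᵥ x = x) : g = 1 := by
  have hc : Filter.Tendsto (fun w => g.1 *ᵥ w) (𝓝[anglePlane] x) (𝓝[anglePlane] x) := by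
    refine tendsto_nhdsWithin_iff.2 ⟨?_, ?_⟩
    · have := (by fun_prop : Continuous fun w => g.1 *ᵥ w).tendsto x
      rw [h] at this
      exact this.mono_left nhdsWithin_le_nhds
    · filter_upwards [self_mem_nhdsWithin] with w hw
      exact (preservesSum_of_mem hg).mem hw
  -- Near `x` both `w` and `g w` lie in `D`, hence are equal.
  refine eq_one_of_fixes_nhdsWithin hx.1
    (Filter.inter_mem (openD_mem_nhdsWithin hx) (hc (openD_mem_nhdsWithin hx))) ?_
  rintro w ⟨hw, hgw⟩
  exact eq_of_mem_D_of_mulVec (G.one_mem) hg (openD_subset hgw) (openD_subset hw) (by simp)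

/-- Points in two tiles are fixed by the element of `G` that takes one tile to the other. -/
lemma fixes_of_mem_translate {g h : GL (Fin 3) ℝ} (hg : g ∈ G) (hh : h ∈ G) {w : Fin 3 → ℝ}
    (hw : w ∈ translate g D) (hw' : w ∈ translate h D) : (g * h⁻¹).1 *ᵥ w = w := by
  obtain ⟨x, hx, rfl⟩ := hw
  obtain ⟨y, hy, hxy⟩ := hw'
  dsimp only at hxy ⊢
  have := eq_of_mem_D_of_mulVec hg hh hx hy hxy.symm
  rw [← hxy, GL_mul_mulVec, GL_inv_mulVec, hxy, this]

/-- Reflections in the sides of `D`. -/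
def sideReflection : Fin 3 → GL (Fin 3) ℝ := ![p13 * p23 * p13, p23, rz]

lemma sideReflection_mem (j : Fin 3) : sideReflection j ∈ G := by
  fin_cases j
  exacts [G.mul_mem (G.mul_mem p13_mem p23_mem) p13_mem, p23_mem, rz_mem]

lemma swap_mulVec (w : Fin 3 → ℝ) : (p13 * p23 * p13).1 *ᵥ w = ![w 1, w 0, w 2] := by
  simp only [GL_mul_mulVec, p13_mulVec, p23_mulVec, cons_val_zero, cons_val_one, cons_val]

lemma sideReflection_ne_one (j : Fin 3) : sideReflection j ≠ 1 := by
  intro h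
  have h' : ∀ i, ((sideReflection j).1 *ᵥ ![1, 2, 3]) i = (![1, 2, 3] : Fin 3 → ℝ) i := by
    simp [h]
  fin_cases j
  · have := h' 0; simp only [sideReflection] at this
    change ((p13 * p23 * p13).1 *ᵥ _) 0 = _ at this
    rw [swap_mulVec] at this; norm_num at this
  · have := h' 1
    change (p23.1 *ᵥ _) 1 = _ at this
    rw [p23_mulVec] at this; simp at this
  · have := h' 0
    change (rz.1 *ᵥ _) 0 = _ at this
    rw [rz_mulVec] at this; simp at this

lemma sideReflection_fixes {j : Fin 3} {v : Fin 3 → ℝ} (h : side j v = 0) :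
    (sideReflection j).1 *ᵥ v = v := by
  fin_cases j
  · change (p13 * p23 * p13).1 *ᵥ v = v
    rw [swap_mulVec]
    have : v 0 = v 1 := by simpa [side, sub_eq_zero] using h
    ext i; fin_cases i <;> simp [this]
  · change p23.1 *ᵥ v = v
    rw [p23_mulVec]
    have : v 1 = v 2 := by simpa [side, sub_eq_zero] using h
    ext i; fin_cases i <;> simp [this]
  · change rz.1 *ᵥ v = v
    rw [rz_mulVec]
    have : v 2 = 0 := by simpa [side] using h
    ext i; fin_cases i <;> simp [this]

/-! ### Matrices that conjugate `G` into itself. -/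

/-- The matrix leaves the angle plane invariant and conjugates `G` into itself. -/
structure ConjugatesIntoG (M : GL (Fin 3) ℝ) : Prop where
  preservesSum : PreservesSum M.1
  exists_conj : ∀ g ∈ G, ∃ h ∈ G, M * g = h * M

/-- The conjugate by `M` of the reflection in a side of `D`. It puts the edges of `MD` into the
reflection set. -/
lemma ConjugatesIntoG.exists_reflection {M : GL (Fin 3) ℝ} (hM : ConjugatesIntoG M) (j : Fin 3) :
    ∃ h ∈ G, h ≠ 1 ∧ ∀ v, side j v = 0 → h.1 *ᵥ (M.1 *ᵥ v) = M.1 *ᵥ v := by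
  obtain ⟨h, hh, e⟩ := hM.exists_conj _ (sideReflection_mem j)
  refine ⟨h, hh, ?_, fun v hv => ?_⟩
  · rintro rfl
    exact sideReflection_ne_one j (by simpa using e)
  · rw [← GL_mul_mulVec, ← e, GL_mul_mulVec, sideReflection_fixes hv]

/-- Otherwise the interior point `g x` of a tile would be fixed by the nontrivial `h` of
`exists_reflection`. Thus side lines of `MD` avoid interiors of tiles. -/
lemma ConjugatesIntoG.side_ne_zero {M : GL (Fin 3) ℝ} (hM : ConjugatesIntoG M) (j : Fin 3)
    {g : GL (Fin 3) ℝ} (hg : g ∈ G) {x : Fin 3 → ℝ} (hx : x ∈ openD) :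
    side j ((M⁻¹ * g).1 *ᵥ x) ≠ 0 := by
  intro h0
  obtain ⟨h, hh, h1, hfix⟩ := hM.exists_reflection j
  have := hfix _ h0
  rw [GL_mul_mulVec, GL_mulVec_inv] at this
  have h2 : g⁻¹ * h * g = 1 := eq_one_of_fixes_openD
    (G.mul_mem (G.mul_mem (G.inv_mem hg) hh) hg) hx
    (by rw [GL_mul_mulVec, GL_mul_mulVec, this, GL_inv_mulVec])
  apply h1
  have h3 : h = g * (g⁻¹ * h * g) * g⁻¹ := by group
  rw [h3, h2]; simp

lemma mem_image_D_iff {M : GL (Fin 3) ℝ} {w : Fin 3 → ℝ} :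
    w ∈ translate M D ↔ M⁻¹.1 *ᵥ w ∈ D :=
  ⟨by rintro ⟨x, hx, rfl⟩; simpa only [GL_inv_mulVec] using hx,
    fun h => ⟨_, h, GL_mulVec_inv M w⟩⟩

/-- A tile that meets the interior of the image of `D` is contained in that image. -/
lemma ConjugatesIntoG.translate_subset {M : GL (Fin 3) ℝ} (hM : ConjugatesIntoG M)
    {g : GL (Fin 3) ℝ} (hg : g ∈ G) {p : Fin 3 → ℝ} (hp : p ∈ translate g D)
    (hpM : ∀ j, 0 < side j (M⁻¹.1 *ᵥ p)) : translate g D ⊆ translate M D := by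
  obtain ⟨p, hp, rfl⟩ := hp
  rintro _ ⟨y, hy, rfl⟩
  rw [mem_image_D_iff, mem_D_iff_side]
  dsimp only at hpM ⊢
  rw [← GL_mul_mulVec]
  refine ⟨(hM.preservesSum.inv.mul (preservesSum_of_mem hg)).mem hy.1, fun j => ?_⟩
  refine nonneg_on_D (β := (side j).comp (mulVecLin (M⁻¹ * g).1))
    (fun x hx => hM.side_ne_zero j hg hx) hp ?_ hy
  simpa only [LinearMap.comp_apply, mulVecLin_apply, GL_mul_mulVec] using hpM j

/-- Only an inclusion of the fixed set is claimed, so one equation `x i = s * x (σ i) + k i` with `σ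
i ≠ i` suffices: `s = 1` fixes a difference, `s = -1` fixes a sum and hence the remaining
coordinate. For `σ = 1` the map is a translation with a fixed point, so the identity, or a half turn
with only one fixed point. -/
lemma exists_reflectionLine {h : GL (Fin 3) ℝ} (hh : h ∈ G) (h1 : h ≠ 1) {p q : Fin 3 → ℝ}
    (hpq : p ≠ q) (hpA : p ∈ anglePlane) (hqA : q ∈ anglePlane) (hp : h.1 *ᵥ p = p)
    (hq : h.1 *ᵥ q = q) :
    ∃ L, IsReflectionLine L ∧ ∀ x ∈ anglePlane, h.1 *ᵥ x = x → x ∈ L := by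
  obtain ⟨s, σ, k, hs, hk⟩ := isCrystallographic_of_mem hh
  have e0 := hk p hpA 0
  have e1 := hk p hpA 1
  have e2 := hk p hpA 2
  have f0 := hk q hqA 0
  have f1 := hk q hqA 1
  have f2 := hk q hqA 2
  rw [hp] at e0 e1 e2
  rw [hq] at f0 f1 f2
  have n01 : σ 0 ≠ σ 1 := σ.injective.ne (by decide)
  have n02 : σ 0 ≠ σ 2 := σ.injective.ne (by decide)
  have n12 : σ 1 ≠ σ 2 := σ.injective.ne (by decide)
  have hpA' := mem_anglePlane.1 hpA
  have hqA' := mem_anglePlane.1 hqA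
  have hne : ¬ (p 0 = q 0 ∧ p 1 = q 1) := fun h => hpq (by
    ext i; fin_cases i
    exacts [h.1, h.2, by simp only [Fin.reduceFinMk]; linarith [h.1, h.2]])
  have hsub : s = 1 → ∀ i j, i ≠ j → σ i = j →
      ∃ L, IsReflectionLine L ∧ ∀ x ∈ anglePlane, h.1 *ᵥ x = x → x ∈ L := by
    rintro rfl i j hij rfl
    refine ⟨_, ⟨k i, Or.inr ⟨i, σ i, hij, rfl⟩⟩, fun x hx hhx => ⟨hx, ?_⟩⟩
    have := hk x hx i
    rw [hhx] at this
    linarith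
  have hcoord : s = -1 → ∀ i j l, (∀ x ∈ anglePlane, x i + x j + x l = 1) → σ i = j →
      ∃ L, IsReflectionLine L ∧ ∀ x ∈ anglePlane, h.1 *ᵥ x = x → x ∈ L := by
    rintro rfl i j l hsum rfl
    refine ⟨_, ⟨1 - k i, Or.inl ⟨l, rfl⟩⟩, fun x hx hhx => ⟨hx, ?_⟩⟩
    have := hk x hx i
    rw [hhx] at this
    push_cast
    linarith [hsum x hx]
  have hid : s = 1 → ¬ (σ 0 = 0 ∧ σ 1 = 1 ∧ σ 2 = 2) := by
    rintro rfl ⟨h0, h1', h2⟩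
    rw [h0] at e0
    rw [h1'] at e1
    rw [h2] at e2
    refine h1 (GL_eq_one fun v hv => ?_)
    ext i
    rw [hk v hv]
    fin_cases i
    · simp only [Fin.zero_eta, h0]; linarith
    · simp only [Fin.mk_one, h1']; linarith
    · simp only [Fin.reduceFinMk, h2]; linarith
  have c0 := fun e => hcoord e 1 2 0 (fun x hx => by rw [← mem_anglePlane.1 hx]; ring)
  have c1 := fun e => hcoord e 0 2 1 (fun x hx => by rw [← mem_anglePlane.1 hx]; ring)
  have c2 := fun e => hcoord e 0 1 2 (fun x hx => by rw [← mem_anglePlane.1 hx])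
  have s0 := fun e => hsub e 1 2 (by decide)
  have s1 := fun e => hsub e 0 2 (by decide)
  have s2 := fun e => hsub e 0 1 (by decide)
  clear hsub hcoord hk
  generalize σ 0 = a at *
  generalize σ 1 = b at *
  generalize σ 2 = c at *
  rcases hs with rfl | rfl <;> fin_cases a <;> fin_cases b <;> fin_cases c <;>
    first
    | contradiction
    | exact s0 rfl rfl
    | exact s1 rfl rfl
    | exact s2 rfl rfl
    | exact c0 rfl rfl
    | exact c1 rfl rfl
    | exact c2 rfl rfl
    | exact absurd ⟨rfl, rfl, rfl⟩ (hid rfl)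
    | (simp only [Fin.zero_eta, Fin.mk_one, Fin.reduceFinMk] at e0 e1 e2 f0 f1 f2
       exact absurd ⟨by linarith, by linarith⟩ hne)

/-! ### Contracting branches and symbolic coding. -/

/-- Branches that contract a bounded distance-like function dominating the metric. -/
structure UniformlyContracting {X : Type*} [MetricSpace X] {n : ℕ} (φ : Fin n → X → X)
    (d : X → X → ℝ) (r B : ℝ) : Prop where
  -- The metric inherited from `Fin 3 → ℝ` is the sup metric; `d` will be the Euclidean distance,
  -- which similarities scale exactly.
  dist_le : ∀ x y, dist x y ≤ d x y
  contract : ∀ i x y, d (φ i x) (φ i y) ≤ r * d x y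
  bounded : ∀ x y, d x y ≤ B
  r_nonneg : 0 ≤ r
  r_lt_one : r < 1
  continuous : ∀ i, Continuous (φ i)

/-- The composition `φ (ω 0) ∘ ⋯ ∘ φ (ω (k - 1))`. -/
def wordMap {X : Type*} {n : ℕ} (φ : Fin n → X → X) : ℕ → (ℕ → Fin n) → X → X
  | 0, _, x => x
  | k + 1, ω, x => φ (ω 0) (wordMap φ k (shift ω) x)

/-- The definition peels off the outermost branch; successive approximations of a code point differ
in the innermost one. -/
lemma wordMap_succ' {X : Type*} {n : ℕ} (φ : Fin n → X → X) (k : ℕ) (ω : ℕ → Fin n) (x : X) :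
    wordMap φ (k + 1) ω x = wordMap φ k ω (φ (ω k) x) := by
  induction k generalizing ω with
  | zero => rfl
  | succ k ih => rw [wordMap, ih (shift ω), wordMap]; rfl

lemma continuous_shift {α : Type*} [TopologicalSpace α] : Continuous (shift (α := α)) :=
  continuous_pi fun _ => continuous_apply _

/-- Prepend a symbol to a sequence. -/
def prepend {α : Type*} (a : α) (ω : ℕ → α) : ℕ → α
  | 0 => a
  | k + 1 => ω k

@[simp] lemma shift_prepend {α : Type*} (a : α) (ω : ℕ → α) : shift (prepend a ω) = ω := rfl

/-- The average of a function over the branches. -/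
noncomputable def branchAverage {X : Type*} {n : ℕ} (φ : Fin n → X → X) (F : X → ℝ) (x : X) : ℝ :=
  (n : ℝ)⁻¹ * ∑ i, F (φ i x)

section Coding

variable {X : Type*} [MetricSpace X] {n : ℕ} {φ : Fin n → X → X} {d : X → X → ℝ} {r B : ℝ}

lemma UniformlyContracting.wordMap_le (h : UniformlyContracting φ d r B) (k : ℕ)
    (ω : ℕ → Fin n) (x y : X) : d (wordMap φ k ω x) (wordMap φ k ω y) ≤ r ^ k * B := by
  induction k generalizing ω with
  | zero => simpa [wordMap] using h.bounded x y
  | succ k ih =>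
    rw [wordMap, wordMap, pow_succ', mul_assoc]
    exact (h.contract _ _ _).trans (mul_le_mul_of_nonneg_left (ih _) h.r_nonneg)

lemma UniformlyContracting.continuous_wordMap (h : UniformlyContracting φ d r B) (k : ℕ) (x : X) :
    Continuous fun ω => wordMap φ k ω x := by
  induction k with
  | zero => exact continuous_const
  | succ k ih =>
    have h1 : Continuous fun p : Fin n × X => φ p.1 p.2 :=
      continuous_prod_of_discrete_left.2 h.continuous
    exact h1.comp ((continuous_apply 0).prodMk (ih.comp continuous_shift))

lemma UniformlyContracting.dist_wordMap_succ (h : UniformlyContracting φ d r B)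
    (ω : ℕ → Fin n) (x : X) (k : ℕ) :
    dist (wordMap φ k ω x) (wordMap φ (k + 1) ω x) ≤ B * r ^ k := by
  rw [wordMap_succ', mul_comm]
  exact (h.dist_le _ _).trans (h.wordMap_le k ω _ _)

/-- A system of contracting branches has a continuous coding map. -/
theorem UniformlyContracting.exists_coding [CompleteSpace X] [Nonempty X]
    (h : UniformlyContracting φ d r B) :
    ∃ c : (ℕ → Fin n) → X, Continuous c ∧ ∀ ω, c ω = φ (ω 0) (c (shift ω)) := by
  obtain ⟨x⟩ := ‹Nonempty X›
  have hlim : ∀ ω, ∃ y, Filter.Tendsto (fun k => wordMap φ k ω x) Filter.atTop (𝓝 y) := fun ω =>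
    cauchySeq_tendsto_of_complete (cauchySeq_of_le_geometric r B h.r_lt_one
      (h.dist_wordMap_succ ω x))
  choose c hc using hlim
  refine ⟨c, ?_, fun ω => ?_⟩
  -- The geometric error bound does not depend on `ω`, so the limit is continuous.
  · have hu : TendstoUniformly (fun k ω => wordMap φ k ω x) c Filter.atTop := by
      rw [Metric.tendstoUniformly_iff]
      intro ε hε
      have h0 : Filter.Tendsto (fun k : ℕ => B * r ^ k / (1 - r)) Filter.atTop (𝓝 0) := by
        have := ((tendsto_pow_atTop_nhds_zero_of_lt_one h.r_nonneg h.r_lt_one).const_mul B).div_const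
          (1 - r)
        simpa using this
      filter_upwards [h0.eventually (gt_mem_nhds hε)] with k hk ω
      rw [dist_comm]
      exact (dist_le_of_le_geometric_of_tendsto r B h.r_lt_one (h.dist_wordMap_succ ω x)
        (hc ω) k).trans_lt hk
    exact hu.continuous (Filter.Frequently.of_forall fun k => h.continuous_wordMap k x)
  · refine tendsto_nhds_unique ((Filter.tendsto_add_atTop_iff_nat 1).2 (hc ω)) ?_
    exact ((h.continuous (ω 0)).tendsto _).comp (hc (shift ω))

variable {f : X → X} {c : (ℕ → Fin n) → X}

lemma semiconj_of_coding {X : Type*} {n : ℕ} {φ : Fin n → X → X} {f : X → X}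
    {c : (ℕ → Fin n) → X} (hf : ∀ i x, f (φ i x) = x) (hc : ∀ ω, c ω = φ (ω 0) (c (shift ω))) :
    Function.Semiconj c shift f := fun ω => by
  rw [hc ω, hf]

lemma iterate_coding {X : Type*} {n : ℕ} {φ : Fin n → X → X} {f : X → X}
    {c : (ℕ → Fin n) → X} (hf : ∀ i x, f (φ i x) = x) (hc : ∀ ω, c ω = φ (ω 0) (c (shift ω)))
    (ω : ℕ → Fin n) (k : ℕ) : f^[k] (c ω) = φ (ω k) (c (shift^[k + 1] ω)) := by
  induction k generalizing ω with
  | zero => exact hc ω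
  | succ k ih =>
    rw [Function.iterate_succ_apply, ← semiconj_of_coding hf hc ω, ih,
      Function.iterate_succ_apply (n := k + 1)]
    rfl

/-- The itinerary of `x` is a code for it: `x` and the coded point are images of two points under
the same `k` branches, hence within `r ^ k * B` for every `k`. -/
lemma UniformlyContracting.coding_surjective (h : UniformlyContracting φ d r B)
    (hf : ∀ i x, f (φ i x) = x) (hc : ∀ ω, c ω = φ (ω 0) (c (shift ω)))
    (hcover : ∀ x, ∃ i y, φ i y = x) : Function.Surjective c := by
  choose i y hy using hcover
  have hy' : ∀ x, φ (i x) (f x) = x := fun x => by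
    have := hf (i x) (y x); rw [hy] at this; rw [this, hy]
  have key : ∀ k x, d x (c fun m => i (f^[m] x)) ≤ r ^ k * B := by
    intro k
    induction k with
    | zero => intro x; simpa using h.bounded _ _
    | succ k ih =>
      intro x
      have h2 : c (fun m => i (f^[m] x)) = φ (i x) (c fun m => i (f^[m] (f x))) := by
        rw [hc]; rfl
      have h3 := h.contract (i x) (f x) (c fun m => i (f^[m] (f x)))
      rw [hy', ← h2] at h3
      rw [pow_succ', mul_assoc]
      exact h3.trans (mul_le_mul_of_nonneg_left (ih _) h.r_nonneg)
  intro x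
  refine ⟨_, (dist_le_zero.1 (ge_of_tendsto' (x := Filter.atTop) (f := fun k : ℕ => r ^ k * B) ?_ fun k =>
    (h.dist_le _ _).trans (key k x))).symm⟩
  have := (tendsto_pow_atTop_nhds_zero_of_lt_one h.r_nonneg h.r_lt_one).mul_const B
  simpa using this

end Coding

/-! ### Branch-invariant measures: uniqueness and mixing. -/

section Invariant

variable {X : Type*} [MetricSpace X] [CompactSpace X] [MeasurableSpace X] [BorelSpace X]
  {n : ℕ} [NeZero n] {φ : Fin n → X → X} {d : X → X → ℝ} {r B : ℝ}

/-- The measure is the average of its images under the branches. -/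
def IsBranchInvariant (φ : Fin n → X → X) (μ : Measure X) : Prop :=
  (n : ENNReal) • μ = ∑ i, μ.map (φ i)

lemma IsBranchInvariant.integral_eq {X : Type*} [MeasurableSpace X] {n : ℕ} [NeZero n]
    {φ : Fin n → X → X} {μ : Measure X} [IsFiniteMeasure μ]
    (hμ : IsBranchInvariant φ μ) (hφ : ∀ i, Measurable (φ i)) {K : X → ℝ} (hK : Measurable K)
    {C : ℝ} (hC : ∀ x, |K x| ≤ C) : ∫ x, K x ∂μ = ∫ x, branchAverage φ K x ∂μ := by
  have hint : ∀ ν : Measure X, IsFiniteMeasure ν → Integrable K ν := fun ν _ =>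
    Integrable.of_bound hK.aestronglyMeasurable C (Filter.Eventually.of_forall hC)
  have hint' : ∀ i, Integrable (fun x => K (φ i x)) μ := fun i =>
    Integrable.of_bound (hK.comp (hφ i)).aestronglyMeasurable C
      (Filter.Eventually.of_forall fun x => hC _)
  have h1 : ∫ x, K x ∂((n : ENNReal) • μ) = ∑ i, ∫ x, K (φ i x) ∂μ := by
    rw [hμ, integral_finsetSum_measure fun i _ => hint _ inferInstance]
    exact Finset.sum_congr rfl fun i _ =>
      integral_map (hφ i).aemeasurable hK.aestronglyMeasurable
  rw [integral_smul_measure] at h1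
  unfold branchAverage
  rw [integral_const_mul, integral_finsetSum _ fun i _ => hint' i, ← h1]
  have : (n : ℝ) ≠ 0 := Nat.cast_ne_zero.2 (NeZero.ne n)
  simp only [ENNReal.toReal_natCast, smul_eq_mul]
  field_simp

lemma UniformlyContracting.continuous_branchAverage {X : Type*} [MetricSpace X] {n : ℕ}
    {φ : Fin n → X → X} {d : X → X → ℝ} {r B : ℝ} (h : UniformlyContracting φ d r B)
    {F : X → ℝ} (hF : Continuous F) : Continuous (branchAverage φ F) :=
  continuous_const.mul (continuous_finsetSum _ fun i _ => hF.comp (h.continuous i))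

lemma UniformlyContracting.continuous_iterate {X : Type*} [MetricSpace X] {n : ℕ}
    {φ : Fin n → X → X} {d : X → X → ℝ} {r B : ℝ} (h : UniformlyContracting φ d r B)
    {F : X → ℝ} (hF : Continuous F) (k : ℕ) : Continuous ((branchAverage φ)^[k] F) := by
  induction k with
  | zero => exact hF
  | succ k ih => rw [Function.iterate_succ_apply']; exact h.continuous_branchAverage ih

lemma exists_abs_le_of_continuous {X : Type*} [TopologicalSpace X] [CompactSpace X] {F : X → ℝ} (hF : Continuous F) : ∃ C, ∀ x, |F x| ≤ C := by
  obtain ⟨C, hC⟩ := isCompact_univ.exists_bound_of_continuousOn hF.continuousOn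
  exact ⟨C, fun x => hC x trivial⟩

lemma UniformlyContracting.integral_iterate (h : UniformlyContracting φ d r B)
    {μ : Measure X} [IsFiniteMeasure μ] (hμ : IsBranchInvariant φ μ) {F : X → ℝ}
    (hF : Continuous F) (k : ℕ) : ∫ x, (branchAverage φ)^[k] F x ∂μ = ∫ x, F x ∂μ := by
  induction k with
  | zero => rfl
  | succ k ih =>
    have hc := h.continuous_iterate hF k
    obtain ⟨C, hC⟩ := exists_abs_le_of_continuous hc
    rw [Function.iterate_succ_apply', ← ih]
    exact (hμ.integral_eq (fun i => (h.continuous i).measurable) hc.measurable hC).symm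

/-- Each averaging step evaluates at points closer by the factor `r`, so small oscillation at scale
`δ` spreads to scale `δ / r ^ k`. -/
lemma UniformlyContracting.oscillation_iterate {X : Type*} [MetricSpace X] {n : ℕ} [NeZero n]
    {φ : Fin n → X → X} {d : X → X → ℝ} {r B : ℝ} (h : UniformlyContracting φ d r B) {F : X → ℝ}
    {ε δ : ℝ} (hF : ∀ x y, d x y ≤ δ → |F x - F y| ≤ ε) (k : ℕ) (x y : X)
    (hxy : r ^ k * d x y ≤ δ) : |(branchAverage φ)^[k] F x - (branchAverage φ)^[k] F y| ≤ ε := by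
  induction k generalizing x y with
  | zero => exact hF x y (by simpa using hxy)
  | succ k ih =>
    have hn : (0 : ℝ) < n := Nat.cast_pos.2 (NeZero.pos n)
    rw [Function.iterate_succ_apply', branchAverage, branchAverage, ← mul_sub,
      ← Finset.sum_sub_distrib, abs_mul, abs_of_pos (inv_pos.2 hn), inv_mul_le_iff₀ hn]
    refine (Finset.abs_sum_le_sum_abs _ _).trans ?_
    have : ∀ i ∈ Finset.univ, |(branchAverage φ)^[k] F (φ i x) - (branchAverage φ)^[k] F (φ i y)|
        ≤ ε := fun i _ => by
      refine ih _ _ (le_trans ?_ hxy)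
      rw [pow_succ, mul_assoc]
      exact mul_le_mul_of_nonneg_left (h.contract i x y) (pow_nonneg h.r_nonneg k)
    simpa using Finset.sum_le_card_nsmul _ _ _ this

/-- The averages of a continuous function over words converge uniformly to its integral. -/
theorem UniformlyContracting.exists_iterate_near (h : UniformlyContracting φ d r B)
    {F : X → ℝ} (hF : Continuous F) {ε : ℝ} (hε : 0 < ε) :
    ∃ K, ∀ k ≥ K, ∀ (μ : Measure X) [IsProbabilityMeasure μ], IsBranchInvariant φ μ → ∀ x,
      |(branchAverage φ)^[k] F x - ∫ y, F y ∂μ| ≤ ε := by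
  obtain ⟨δ, hδ, hu⟩ := Metric.uniformContinuous_iff.1
    (CompactSpace.uniformContinuous_of_continuous hF) ε hε
  have hosc : ∀ x y, d x y ≤ δ / 2 → |F x - F y| ≤ ε := fun x y hxy =>
    (hu (by linarith [h.dist_le x y] : dist x y < δ)).le
  have h0 : Filter.Tendsto (fun k : ℕ => r ^ k * B) Filter.atTop (𝓝 0) := by
    simpa using (tendsto_pow_atTop_nhds_zero_of_lt_one h.r_nonneg h.r_lt_one).mul_const B
  obtain ⟨K, hK⟩ := Filter.eventually_atTop.1 (h0.eventually (gt_mem_nhds (half_pos hδ)))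
  -- `K` is chosen before the measure; uniqueness compares two measures with the same `K`.
  refine ⟨K, fun k hk μ _ hμ x => ?_⟩
  have hosc' : ∀ y, |(branchAverage φ)^[k] F x - (branchAverage φ)^[k] F y| ≤ ε := fun y =>
    h.oscillation_iterate hosc k x y
      ((mul_le_mul_of_nonneg_left (h.bounded x y) (pow_nonneg h.r_nonneg k)).trans (hK k hk).le)
  have hc := h.continuous_iterate hF k
  obtain ⟨C, hC⟩ := exists_abs_le_of_continuous hc
  have hint : Integrable ((branchAverage φ)^[k] F) μ :=
    Integrable.of_bound hc.measurable.aestronglyMeasurable C (Filter.Eventually.of_forall hC)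
  rw [← h.integral_iterate hμ hF k]
  have : (branchAverage φ)^[k] F x - ∫ y, (branchAverage φ)^[k] F y ∂μ =
      ∫ y, ((branchAverage φ)^[k] F x - (branchAverage φ)^[k] F y) ∂μ := by
    rw [integral_sub (integrable_const _) hint]; simp
  rw [this]
  have := norm_integral_le_of_norm_le_const (μ := μ)
    (f := fun y => (branchAverage φ)^[k] F x - (branchAverage φ)^[k] F y)
    (Filter.Eventually.of_forall hosc')
  simpa using this

/-- Contracting branches have at most one invariant probability measure. -/
theorem UniformlyContracting.measure_unique (h : UniformlyContracting φ d r B)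
    {μ ν : Measure X} [IsProbabilityMeasure μ] [IsProbabilityMeasure ν]
    (hμ : IsBranchInvariant φ μ) (hν : IsBranchInvariant φ ν) : μ = ν := by
  have : Nonempty X := nonempty_of_isProbabilityMeasure μ
  obtain ⟨x⟩ := this
  refine ext_of_forall_integral_eq_of_IsFiniteMeasure fun F => ?_
  refine eq_of_forall_dist_le fun ε hε => ?_
  obtain ⟨K, hK⟩ := h.exists_iterate_near F.continuous (half_pos hε)
  have h1 := hK K le_rfl μ hμ x
  have h2 := hK K le_rfl ν hν x
  rw [Real.dist_eq]
  rw [abs_le] at *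
  constructor <;> linarith

variable {f : X → X}

/-- Since `f ∘ φ i = id`, each of the `n` image measures gives `f ⁻¹' s` the mass `μ s`. -/
lemma IsBranchInvariant.measurePreserving {X : Type*} [MeasurableSpace X] {n : ℕ} [NeZero n]
    {φ : Fin n → X → X} {f : X → X}
    {μ : Measure X} (hμ : IsBranchInvariant φ μ)
    (hφ : ∀ i, Measurable (φ i)) (hf : ∀ i x, f (φ i x) = x) (hfm : Measurable f) :
    MeasurePreserving f μ μ := by
  refine ⟨hfm, ?_⟩
  have h1 : (n : ENNReal) • μ.map f = (n : ENNReal) • μ := by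
    ext s hs
    have h2 : (n : ENNReal) * μ (f ⁻¹' s) = ∑ i, μ.map (φ i) (f ⁻¹' s) := by
      have := congrArg (fun m => m (f ⁻¹' s)) hμ
      simpa using this
    have h3 : ∀ i, μ.map (φ i) (f ⁻¹' s) = μ s := fun i => by
      rw [Measure.map_apply (hφ i) (hfm hs)]
      congr 1
      ext x; simp [hf]
    simp [Measure.map_apply hfm hs, h2, h3]
  have hn0 : (n : ENNReal) ≠ 0 := by exact_mod_cast NeZero.ne n
  have := congrArg (fun m => (n : ENNReal)⁻¹ • m) h1
  simpa only [smul_smul, ENNReal.inv_mul_cancel hn0 (ENNReal.natCast_ne_top n), one_smul] using this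

/-- Duality: averaging over branches is the adjoint of composition with `f`. -/
lemma UniformlyContracting.integral_comp_mul (h : UniformlyContracting φ d r B) {μ : Measure X}
    [IsFiniteMeasure μ] (hμ : IsBranchInvariant φ μ) (hf : ∀ i x, f (φ i x) = x)
    (hfm : Measurable f) {K : X → ℝ} (hK : Measurable K) {C : ℝ} (hC : ∀ x, |K x| ≤ C)
    {F : X → ℝ} (hF : Continuous F) (k : ℕ) :
    ∫ x, K (f^[k] x) * F x ∂μ = ∫ x, K x * (branchAverage φ)^[k] F x ∂μ := by
  induction k generalizing F with
  | zero => rfl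
  | succ k ih =>
    rw [Function.iterate_succ_apply, ← ih (h.continuous_branchAverage hF)]
    obtain ⟨C', hC'⟩ := exists_abs_le_of_continuous hF
    rw [hμ.integral_eq (K := fun x => K (f^[k + 1] x) * F x) (C := C * C')
      (fun i => (h.continuous i).measurable)
      ((hK.comp (hfm.iterate (k + 1))).mul hF.measurable) fun x => by
        rw [abs_mul]
        exact mul_le_mul (hC _) (hC' _) (abs_nonneg _) ((abs_nonneg _).trans (hC x))]
    refine integral_congr_ae (Filter.Eventually.of_forall fun x => ?_)
    simp only [branchAverage, Function.iterate_succ_apply, hf, ← Finset.mul_sum]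
    ring

/-- The expanding map with contracting inverse branches is mixing for the invariant measure. -/
theorem UniformlyContracting.isMixing (h : UniformlyContracting φ d r B) {μ : Measure X}
    [IsProbabilityMeasure μ] (hμ : IsBranchInvariant φ μ) (hf : ∀ i x, f (φ i x) = x)
    (hfm : Measurable f) : IsMixing f μ := by
  have hmp := hμ.measurePreserving (fun i => (h.continuous i).measurable) hf hfm
  refine ⟨hmp, fun s t hs ht => ?_⟩
  suffices Filter.Tendsto (fun k : ℕ => μ.real (f^[k] ⁻¹' s ∩ t)) Filter.atTop
      (𝓝 (μ.real s * μ.real t)) by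
    have h1 := ENNReal.tendsto_ofReal this
    rw [ENNReal.ofReal_mul measureReal_nonneg] at h1
    simpa using h1
  rw [Metric.tendsto_atTop]
  intro ε hε
  have hKm : Measurable (s.indicator (1 : X → ℝ)) := measurable_one.indicator hs
  have hK0 : ∀ x, 0 ≤ s.indicator (1 : X → ℝ) x := Set.indicator_nonneg fun _ _ => zero_le_one
  have hK1 : ∀ x, s.indicator (1 : X → ℝ) x ≤ 1 := fun x =>
    Set.indicator_apply_le' (fun _ => le_rfl) (fun _ => zero_le_one)
  have hKb : ∀ x, |s.indicator (1 : X → ℝ) x| ≤ 1 := fun x => by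
    rw [abs_of_nonneg (hK0 x)]; exact hK1 x
  have htint : Integrable (t.indicator (1 : X → ℝ)) μ := (integrable_const 1).indicator ht
  -- Only the indicator of `t` must be continuous for the averaging; that of `s` needs only to be
  -- bounded and measurable. Three errors of `ε / 4` add up.
  obtain ⟨F, hFt, hFint⟩ := htint.exists_boundedContinuous_integral_sub_le (ε := ε / 4) (by linarith)
  obtain ⟨N, hN⟩ := h.exists_iterate_near F.continuous (ε := ε / 4) (by linarith)
  refine ⟨N, fun k hk => ?_⟩
  have hkm := hfm.iterate k
  set K := s.indicator (1 : X → ℝ) with hKdef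
  set χ := t.indicator (1 : X → ℝ) with hχdef
  have hK : ∫ x, K x ∂μ = μ.real s := integral_indicator_one hs
  have hχ : ∫ x, χ x ∂μ = μ.real t := integral_indicator_one ht
  have hKχ : ∫ x, K (f^[k] x) * χ x ∂μ = μ.real (f^[k] ⁻¹' s ∩ t) := by
    rw [← integral_indicator_one ((hkm hs).inter ht)]
    refine integral_congr_ae (Filter.Eventually.of_forall fun x => ?_)
    by_cases h1 : f^[k] x ∈ s <;> by_cases h2 : x ∈ t <;>
      simp [hKdef, hχdef, h1, h2]
  have hbd : ∀ {H : X → ℝ}, Integrable H μ → Integrable (fun x => K (f^[k] x) * H x) μ :=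
    fun hH => hH.bdd_mul (c := 1) (hKm.comp hkm).aestronglyMeasurable
      (Filter.Eventually.of_forall fun x => hKb _)
  have h1 : |∫ x, K (f^[k] x) * χ x ∂μ - ∫ x, K (f^[k] x) * F x ∂μ| ≤ ε / 4 := by
    rw [← integral_sub (hbd htint) (hbd hFint)]
    refine (abs_integral_le_integral_abs).trans (le_trans ?_ hFt)
    refine integral_mono ((hbd htint).sub (hbd hFint)).abs (htint.sub hFint).norm fun x => ?_
    rw [← mul_sub, abs_mul, Real.norm_eq_abs]
    exact mul_le_of_le_one_left (abs_nonneg _) (hKb _)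
  have h2 : |∫ x, K x * (branchAverage φ)^[k] F x ∂μ - (∫ x, K x ∂μ) * ∫ x, F x ∂μ| ≤ ε / 4 := by
    have hc := h.continuous_iterate F.continuous k
    obtain ⟨C, hC⟩ := exists_abs_le_of_continuous hc
    have hint : Integrable (fun x => K x * (branchAverage φ)^[k] F x) μ :=
      Integrable.of_bound (hKm.mul hc.measurable).aestronglyMeasurable (1 * C)
        (Filter.Eventually.of_forall fun x => by
          rw [Real.norm_eq_abs, abs_mul]
          exact mul_le_mul (hKb x) (hC x) (abs_nonneg _) zero_le_one)
    have hKint : Integrable K μ := (integrable_const 1).indicator hs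
    rw [← integral_mul_const, ← integral_sub hint (hKint.mul_const _)]
    have h3 : ∀ x, ‖K x * (branchAverage φ)^[k] F x - K x * ∫ x, F x ∂μ‖ ≤ ε / 4 := fun x => by
      rw [← mul_sub, Real.norm_eq_abs, abs_mul]
      exact (mul_le_of_le_one_left (abs_nonneg _) (hKb _)).trans (hN k hk μ hμ x)
    simpa using norm_integral_le_of_norm_le_const (μ := μ) (Filter.Eventually.of_forall h3)
  have h3 : |(∫ x, K x ∂μ) * ∫ x, F x ∂μ - (∫ x, K x ∂μ) * ∫ x, χ x ∂μ| ≤ ε / 4 := by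
    rw [← mul_sub, abs_mul, abs_sub_comm]
    refine (mul_le_of_le_one_left (abs_nonneg _) ?_).trans ?_
    · rw [hK, abs_of_nonneg measureReal_nonneg]; exact measureReal_le_one
    · rw [← integral_sub htint hFint]
      exact (abs_integral_le_integral_abs).trans hFt
  rw [h.integral_comp_mul hμ hf hfm hKm hKb F.continuous k] at h1
  rw [Real.dist_eq, ← hKχ, ← hK, ← hχ]
  rw [abs_le] at h1 h2 h3
  rw [abs_lt]
  constructor <;> linarith

end Invariant

/-! ### The Bernoulli measure as an invariant measure, and ergodicity from mixing. -/

lemma measurable_prepend {α : Type*} [MeasurableSpace α] (a : α) :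
    Measurable (prepend a : (ℕ → α) → ℕ → α) :=
  measurable_pi_iff.2 fun k => by
    cases k with
    | zero => exact measurable_const
    | succ k => exact measurable_pi_apply k

lemma isProbabilityMeasure_bernoulliMeasure (n : ℕ) [NeZero n] :
    IsProbabilityMeasure (bernoulliMeasure n) := by
  unfold bernoulliMeasure; infer_instance

/-- It suffices to test cylinders, which determine a product measure. A constraint `t 0` on the
first symbol admits the fraction `|t 0| / n` of the branches; the other constraints shift down by
one place. -/
lemma bernoulliMeasure_eq_sum (n : ℕ) [NeZero n] :
    (n : ENNReal) • bernoulliMeasure n = ∑ i, (bernoulliMeasure n).map (prepend i) := by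
  classical
  have hn0 : (n : ENNReal) ≠ 0 := by exact_mod_cast NeZero.ne n
  have hnt : (n : ENNReal) ≠ ⊤ := ENNReal.natCast_ne_top n
  suffices (n : ENNReal)⁻¹ • ∑ i, (bernoulliMeasure n).map (prepend i) = bernoulliMeasure n by
    rw [← this, smul_smul, ENNReal.mul_inv_cancel hn0 hnt, one_smul, this]
  refine Measure.eq_infinitePi _ fun s t ht => ?_
  have hmt : MeasurableSet (Set.pi (s : Set ℕ) t) :=
    MeasurableSet.pi s.countable_toSet fun i _ => ht i
  have key : ∀ i : Fin n, (bernoulliMeasure n).map (prepend i) (Set.pi s t) =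
      if 0 ∈ s → i ∈ t 0 then ∏ k ∈ s.erase 0, ProbabilityTheory.uniformOn Set.univ (t k) else 0 := by
    intro i
    rw [Measure.map_apply (measurable_prepend i) hmt]
    split_ifs with hi
    · have : prepend i ⁻¹' (Set.pi s t) =
          Set.pi ((s.erase 0).image Nat.pred : Finset ℕ) (fun k => t (k + 1)) := by
        ext ω
        simp only [Set.mem_preimage, Set.mem_pi, Finset.coe_image, Finset.mem_coe, Set.mem_image,
          Finset.mem_erase]
        constructor
        · rintro h _ ⟨k, ⟨hk0, hk⟩, rfl⟩
          obtain ⟨k, rfl⟩ := Nat.exists_eq_succ_of_ne_zero hk0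
          exact h _ hk
        · intro h k hk
          cases k with
          | zero => exact hi hk
          | succ k => exact h k ⟨k + 1, ⟨by simp, hk⟩, rfl⟩
      rw [this, bernoulliMeasure, Measure.infinitePi_pi _ fun k _ => ht _, Finset.prod_image]
      · refine Finset.prod_congr rfl fun k hk => ?_
        rw [Nat.pred_eq_sub_one, Nat.sub_add_cancel (Nat.pos_of_ne_zero (Finset.ne_of_mem_erase hk))]
      · intro a ha b hb hab
        exact Nat.pred_inj (Nat.pos_of_ne_zero (Finset.ne_of_mem_erase ha))
          (Nat.pos_of_ne_zero (Finset.ne_of_mem_erase hb)) hab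
    · have : prepend i ⁻¹' (Set.pi s t) = ∅ := by
        ext ω
        simp only [Set.mem_preimage, Set.mem_pi, Set.mem_empty_iff_false, iff_false]
        intro h
        exact hi fun h0 => h 0 h0
      rw [this, measure_empty]
  simp only [Measure.smul_apply, Measure.coe_finsetSum, Finset.sum_apply, key, smul_eq_mul]
  by_cases h0 : 0 ∈ s
  · rw [← Finset.mul_prod_erase s _ h0, ProbabilityTheory.uniformOn_univ,
      Measure.count_apply (ht 0), ← Finset.sum_filter]
    simp only [h0, forall_const, Finset.sum_const, nsmul_eq_mul, Fintype.card_fin]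
    rw [← mul_assoc, ENNReal.div_eq_inv_mul]
    congr 2
    rw [Set.encard_eq_coe_toFinset_card, Set.filter_mem_univ_eq_toFinset]
    simp
  · rw [Finset.erase_eq_of_notMem h0]
    simp only [h0, IsEmpty.forall_iff, if_true, Finset.sum_const, Finset.card_univ,
      Fintype.card_fin, nsmul_eq_mul]
    rw [← mul_assoc, ENNReal.inv_mul_cancel hn0 hnt, one_mul]

/-- The coding map intertwines `prepend i` with `φ i`. -/
lemma isBranchInvariant_map_coding {X : Type*} [MeasurableSpace X] [MetricSpace X] {n : ℕ}
    [NeZero n] {φ : Fin n → X → X} {c : (ℕ → Fin n) → X} (hφ : ∀ i, Measurable (φ i))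
    (hcm : Measurable c) (hc : ∀ ω, c ω = φ (ω 0) (c (shift ω))) :
    IsBranchInvariant φ ((bernoulliMeasure n).map c) := by
  unfold IsBranchInvariant
  rw [← Measure.map_smul, bernoulliMeasure_eq_sum]
  ext s hs
  rw [Measure.map_apply hcm hs]
  simp only [Measure.coe_finsetSum, Finset.sum_apply]
  refine Finset.sum_congr rfl fun i _ => ?_
  rw [Measure.map_apply (measurable_prepend i) (hcm hs), Measure.map_apply (hφ i) hs,
    Measure.map_apply hcm (hφ i hs)]
  congr 1
  ext ω
  simp only [Set.mem_preimage, hc (prepend i ω), shift_prepend]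
  rfl

/-- Mixing of an invariant set with itself gives `μ s * μ s = μ s`. -/
lemma IsMixing.ergodic {X : Type*} [MeasurableSpace X] {f : X → X} {μ : Measure X}
    [IsProbabilityMeasure μ] (h : IsMixing f μ) : Ergodic f μ := by
  refine ⟨h.measurePreserving, ⟨fun s hs hfs => ?_⟩⟩
  have h1 := h.mixing s s hs hs
  have h2 : ∀ k : ℕ, f^[k] ⁻¹' s = s := fun k => by
    induction k with
    | zero => rfl
    | succ k ih => rw [Function.iterate_succ, Set.preimage_comp, ih, hfs]
  simp only [h2, Set.inter_self] at h1
  have h3 : μ s * μ s = μ s := tendsto_nhds_unique h1 tendsto_const_nhds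
  have h4 : μ s = 0 ∨ μ s = 1 := by
    rcases eq_or_ne (μ s) 0 with h | h
    · exact Or.inl h
    · refine Or.inr ((ENNReal.mul_right_inj h (measure_ne_top _ _)).1 (h3.trans (mul_one _).symm))
  rw [Filter.eventuallyConst_set']
  rcases h4 with h | h
  · exact Or.inl (ae_eq_empty.2 h)
  · exact Or.inr (ae_eq_univ.2 ((prob_compl_eq_zero_iff hs).2 h))

/-! ### Lebesgue measure on the plane, and ATMs conjugate `G` into itself. -/

/-- The parametrization of the angle plane by its first two coordinates. -/
def planeChart (p : ℝ × ℝ) : Fin 3 → ℝ := ![p.1, p.2, 1 - p.1 - p.2]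

lemma planeChart_mem (p : ℝ × ℝ) : planeChart p ∈ anglePlane := by
  simp [mem_anglePlane, planeChart]

lemma continuous_planeChart : Continuous planeChart := by
  refine continuous_pi fun i => ?_
  fin_cases i <;> simp [planeChart] <;> fun_prop

lemma planeChart_of_mem {v : Fin 3 → ℝ} (hv : v ∈ anglePlane) : planeChart (v 0, v 1) = v := by
  rw [mem_anglePlane] at hv
  ext i; fin_cases i <;> simp [planeChart]; linarith

/-- Lebesgue measure on the angle plane, in the chart `planeChart`. -/
noncomputable def planeMeasure : Measure (Fin 3 → ℝ) := volume.map planeChart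

lemma planeMeasure_apply {S : Set (Fin 3 → ℝ)} (hS : MeasurableSet S) :
    planeMeasure S = volume (planeChart ⁻¹' S) :=
  Measure.map_apply continuous_planeChart.measurable hS

/-- `planeChart` as an affine map. -/
noncomputable def planeChartAffine : ℝ × ℝ →ᵃ[ℝ] (Fin 3 → ℝ) where
  toFun := planeChart
  linear := LinearMap.pi ![LinearMap.fst ℝ ℝ ℝ, LinearMap.snd ℝ ℝ ℝ,
    -LinearMap.fst ℝ ℝ ℝ - LinearMap.snd ℝ ℝ ℝ]
  map_vadd' p v := by
    ext i; fin_cases i <;> simp [planeChart]; ring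

/-- The plane spans the space, so it meets the kernel of a nonzero matrix in a proper affine
subspace, which is null. -/
lemma planeMeasure_mulVec_eq_zero {K : Matrix (Fin 3) (Fin 3) ℝ} (hK : K ≠ 0) :
    planeMeasure {w | K *ᵥ w = 0} = 0 := by
  have hcl : IsClosed {w | K *ᵥ w = 0} := isClosed_eq (by fun_prop) continuous_const
  rw [planeMeasure_apply hcl.measurableSet]
  let s : AffineSubspace ℝ (ℝ × ℝ) :=
    (LinearMap.ker (mulVecLin K)).toAffineSubspace.comap planeChartAffine
  have hs : planeChart ⁻¹' {w | K *ᵥ w = 0} = s := by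
    ext p; simp [s, planeChartAffine]
  rw [hs]
  refine Measure.addHaar_affineSubspace _ _ fun htop => hK ?_
  refine eq_of_eqOn_anglePlane fun v hv => ?_
  have : (v 0, v 1) ∈ (s : Set (ℝ × ℝ)) := by rw [htop]; trivial
  rw [← hs, Set.mem_preimage, planeChart_of_mem hv] at this
  simpa using this

lemma planeMeasure_fixes_eq_zero {g : GL (Fin 3) ℝ} (hg : g ≠ 1) :
    planeMeasure {w | g.1 *ᵥ w = w} = 0 := by
  have h : g.1 - 1 ≠ 0 := fun h => hg (Units.ext (sub_eq_zero.1 h))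
  rw [← planeMeasure_mulVec_eq_zero h]
  congr 1
  ext w
  simp [sub_mulVec, sub_eq_zero]

lemma planeMeasure_univ_ne_zero : planeMeasure Set.univ ≠ 0 := by
  rw [planeMeasure_apply .univ, Set.preimage_univ]
  exact (Measure.measure_univ_pos.2 (NeZero.ne _)).ne'

/-- The sign, permutation and integer vector determine the action on the plane, hence the matrix. -/
lemma countable_G : Countable G := by
  choose s σ k hs hk using fun g : G => isCrystallographic_of_mem g.2
  refine Function.Injective.countable
    (f := fun g : G => ((if s g = 1 then 1 else 0 : ℕ), σ g, k g)) fun g h hgh => ?_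
  simp only [Prod.mk.injEq] at hgh
  obtain ⟨h1, h2, h3⟩ := hgh
  have hs' : s g = s h := by
    rcases hs g with e | e <;> rcases hs h with e' | e' <;> rw [e, e'] at h1 <;>
      first | (rw [e, e']; done) | (exfalso; norm_num at h1)
  refine Subtype.ext (Units.ext (eq_of_eqOn_anglePlane fun v hv => ?_))
  ext i
  rw [hk g v hv, hk h v hv, hs', h2, h3]

/-- Angle transition matrices normalize `G` in the sense that they conjugate it into itself. -/
theorem IsATM.conjugatesIntoG {M : GL (Fin 3) ℝ} (hM : IsATM M.1) : ConjugatesIntoG M := by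
  have hsum : PreservesSum M.1 := preservesSum_of_mapsTo hM.mapsTo
  refine ⟨hsum, fun g hg => ?_⟩
  by_contra! hne
  have := countable_G
  apply planeMeasure_univ_ne_zero
  -- Pointwise some `h ∈ G` satisfies `M g v = h M v`, so these countably many kernels cover the
  -- plane; if no `h` worked globally, all of them would be null.
  have hcover : planeMeasure (⋃ h : G, {w | (M.1 * g.1 - h.1.1 * M.1) *ᵥ w = 0})ᶜ = 0 := by
    have hm : MeasurableSet (⋃ h : G, {w | (M.1 * g.1 - h.1.1 * M.1) *ᵥ w = 0})ᶜ :=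
      (MeasurableSet.iUnion fun h => (isClosed_eq (by fun_prop) continuous_const).measurableSet).compl
    rw [planeMeasure_apply hm]
    convert measure_empty (μ := (volume : Measure (ℝ × ℝ)))
    rw [Set.eq_empty_iff_forall_notMem]
    intro p hp
    apply hp
    have hv := planeChart_mem p
    obtain ⟨h, hh, e⟩ := (hM.reexpr _ ((preservesSum_of_mem hg).mem hv) _ hv
      (Reexpr.of_mem hg hv)).exists_mem (hsum.mem ((preservesSum_of_mem hg).mem hv)) (hsum.mem hv)
    refine Set.mem_iUnion.2 ⟨⟨h, hh⟩, ?_⟩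
    change (M.1 * g.1 - h.1 * M.1) *ᵥ planeChart p = 0
    rw [sub_mulVec, ← mulVec_mulVec, ← mulVec_mulVec, e, sub_self]
  refine le_antisymm ?_ zero_le
  rw [← Set.union_compl_self (⋃ h : G, {w | (M.1 * g.1 - h.1.1 * M.1) *ᵥ w = 0})]
  refine (measure_union_le _ _).trans (le_of_eq ?_)
  rw [hcover, add_zero, measure_iUnion_null_iff]
  intro h
  refine planeMeasure_mulVec_eq_zero fun h0 => hne h.1 h.2 (Units.ext ?_)
  rw [Units.val_mul, Units.val_mul]
  exact sub_eq_zero.1 h0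

/-! ### Determinant, area scaling and the similarity property. -/

lemma PreservesSum.column {K : Matrix (Fin 3) (Fin 3) ℝ} (h : PreservesSum K) (j : Fin 3) :
    K 2 j = 1 - K 0 j - K 1 j := by
  have := h (Pi.single j 1)
  have h1 : (Pi.single j 1 : Fin 3 → ℝ) 0 + (Pi.single j 1 : Fin 3 → ℝ) 1 +
      (Pi.single j 1 : Fin 3 → ℝ) 2 = 1 := by fin_cases j <;> simp
  simp only [mulVec_single_one, h1, col_apply] at this
  linarith

/-- The matrix acts trivially modulo the sum-zero plane, so its determinant is that of the linear
part there. -/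
lemma PreservesSum.det {K : Matrix (Fin 3) (Fin 3) ℝ} (h : PreservesSum K) :
    K.det = (K 0 0 - K 0 2) * (K 1 1 - K 1 2) - (K 0 1 - K 0 2) * (K 1 0 - K 1 2) := by
  rw [det_fin_three, h.column 0, h.column 1, h.column 2]
  ring

/-- The linear part of a sum preserving matrix, in the chart `planeChart`. -/
noncomputable def planeLinear (K : Matrix (Fin 3) (Fin 3) ℝ) : ℝ × ℝ →ₗ[ℝ] ℝ × ℝ :=
  Matrix.toLin (Module.Basis.finTwoProd ℝ) (Module.Basis.finTwoProd ℝ)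
    !![K 0 0 - K 0 2, K 0 1 - K 0 2; K 1 0 - K 1 2, K 1 1 - K 1 2]

lemma PreservesSum.det_planeLinear {K : Matrix (Fin 3) (Fin 3) ℝ} (h : PreservesSum K) :
    LinearMap.det (planeLinear K) = K.det := by
  rw [planeLinear, LinearMap.det_toLin, det_fin_two_of, h.det]

lemma PreservesSum.mulVec_planeChart {K : Matrix (Fin 3) (Fin 3) ℝ} (h : PreservesSum K)
    (p : ℝ × ℝ) : K *ᵥ planeChart p = planeChart (planeLinear K p + (K 0 2, K 1 2)) := by
  rw [← planeChart_of_mem (h.mem (planeChart_mem p)), planeLinear, Matrix.toLin_finTwoProd_apply]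
  congr 1
  ext <;> simp [mulVec, dotProduct, Fin.sum_univ_three, planeChart] <;> ring

lemma planeMeasure_translate {K : GL (Fin 3) ℝ} (h : PreservesSum K.1) {Y : Set (Fin 3 → ℝ)}
    (hY : MeasurableSet Y) :
    planeMeasure (translate K Y) = ENNReal.ofReal |K.1.det| * planeMeasure Y := by
  have himg : translate K Y = (fun w => K⁻¹.1 *ᵥ w) ⁻¹' Y := by
    ext w
    exact ⟨by rintro ⟨x, hx, rfl⟩; simpa only [Set.mem_preimage, GL_inv_mulVec] using hx,
      fun hw => ⟨_, hw, GL_mulVec_inv K w⟩⟩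
  have hm : MeasurableSet (translate K Y) := by
    rw [himg]
    exact (by fun_prop : Continuous fun w => K⁻¹.1 *ᵥ w).measurable hY
  rw [planeMeasure_apply hm, planeMeasure_apply hY]
  have : planeChart ⁻¹' (translate K Y) =
      (fun q => q + (K.1 0 2, K.1 1 2)) '' (planeLinear K.1 '' (planeChart ⁻¹' Y)) := by
    rw [Set.image_image]
    ext q
    constructor
    · rintro ⟨y, hy, hyq⟩
      dsimp only at hyq
      have hyA : y ∈ anglePlane := by
        rw [← GL_inv_mulVec K y, hyq]; exact h.inv.mem (planeChart_mem q)
      refine ⟨(y 0, y 1), by rwa [Set.mem_preimage, planeChart_of_mem hyA], ?_⟩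
      have h1 := h.mulVec_planeChart (y 0, y 1)
      rw [planeChart_of_mem hyA, hyq] at h1
      have h2 := congrFun h1 0
      have h3 := congrFun h1 1
      exact (Prod.ext h2 h3).symm
    · rintro ⟨p, hp, rfl⟩
      exact ⟨planeChart p, hp, h.mulVec_planeChart p⟩
  rw [this, Set.image_add_right, measure_preimage_add_right, Measure.addHaar_image_linearMap,
    h.det_planeLinear]

/-- The square of the Euclidean norm. -/
def normSq (u : Fin 3 → ℝ) : ℝ := u 0 ^ 2 + u 1 ^ 2 + u 2 ^ 2

lemma normSq_mulVec_of_mem {g : GL (Fin 3) ℝ} (hg : g ∈ G) {u : Fin 3 → ℝ}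
    (hu : u 0 + u 1 + u 2 = 0) : normSq (g.1 *ᵥ u) = normSq u := by
  obtain ⟨s, σ, k, hs, hk⟩ := isCrystallographic_of_mem hg
  have hss : s ^ 2 = 1 := by rcases hs with rfl | rfl <;> norm_num
  -- The translation `k` cancels in the difference of two points of the plane.
  have h1 : ∀ i, (g.1 *ᵥ u) i = s * u (σ i) := by
    intro i
    have hA : (![1, 0, 0] : Fin 3 → ℝ) ∈ anglePlane := by simp [mem_anglePlane]
    have hA' : u + ![1, 0, 0] ∈ anglePlane := by
      rw [mem_anglePlane]; simp only [Pi.add_apply, cons_val_zero, cons_val_one, cons_val]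
      linear_combination hu
    have e1 := hk _ hA i
    have e2 := hk _ hA' i
    rw [mulVec_add, Pi.add_apply, e1, Pi.add_apply] at e2
    linear_combination e2
  have h2 : ∑ i, u (σ i) ^ 2 = ∑ i, u i ^ 2 := Equiv.sum_comp σ fun i => u i ^ 2
  rw [Fin.sum_univ_three, Fin.sum_univ_three] at h2
  simp only [normSq, h1]
  linear_combination h2 + (u (σ 0) ^ 2 + u (σ 1) ^ 2 + u (σ 2) ^ 2) * hss

lemma ConjugatesIntoG.normSq_mulVec_of_mem {M : GL (Fin 3) ℝ} (hM : ConjugatesIntoG M)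
    {g : GL (Fin 3) ℝ} (hg : g ∈ G) {u : Fin 3 → ℝ} (hu : u 0 + u 1 + u 2 = 0) :
    normSq (M.1 *ᵥ (g.1 *ᵥ u)) = normSq (M.1 *ᵥ u) := by
  obtain ⟨h, hh, e⟩ := hM.exists_conj g hg
  rw [← GL_mul_mulVec, e, GL_mul_mulVec, TriangleDynamics.normSq_mulVec_of_mem hh]
  rw [hM.preservesSum, hu]

/-- A matrix that conjugates `G` into itself acts on the angle plane as a similarity. -/
theorem ConjugatesIntoG.normSq_mulVec {M : GL (Fin 3) ℝ} (hM : ConjugatesIntoG M)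
    {u : Fin 3 → ℝ} (hu : u 0 + u 1 + u 2 = 0) :
    normSq (M.1 *ᵥ u) = |M.1.det| * normSq u := by
  -- The images of `(1, -1, 0)`, `(0, -1, 1)` and `(1, 0, -1)` have equal length, which determines
  -- the pulled-back form up to a factor.
  have e1 := hM.normSq_mulVec_of_mem p13_mem (u := ![1, -1, 0]) (by simp)
  have e2 := hM.normSq_mulVec_of_mem p23_mem (u := ![1, -1, 0]) (by simp)
  rw [p13_mulVec] at e1
  rw [p23_mulVec] at e2
  have hdet := hM.preservesSum.det
  simp only [normSq, mulVec, dotProduct, Fin.sum_univ_three, hM.preservesSum.column,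
    cons_val_zero, cons_val_one, cons_val] at e1 e2 ⊢
  set K := M.1
  set a := K 0 0 - K 0 2 with ha
  set b := K 1 0 - K 1 2 with hb
  set c := K 0 1 - K 0 2 with hc
  set d := K 1 1 - K 1 2 with hd
  have f1 : c ^ 2 + d ^ 2 + c * d = a ^ 2 + b ^ 2 + a * b := by
    rw [ha, hb, hc, hd]; linear_combination (e1 - e2) / 2
  have f2 : 2 * a * c + 2 * b * d + a * d + b * c = a ^ 2 + b ^ 2 + a * b := by
    rw [ha, hb, hc, hd] at f1 ⊢; linear_combination e2 / 2 + f1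
  -- Gram identity `4 Q(x) Q(y) - B(x,y)² = 3 det²` for `Q(a, b) = a² + ab + b²` and its polar form
  -- `B`, with `Q(x) = Q(y) = B(x,y)`.
  have hsq : K.det ^ 2 = (a ^ 2 + b ^ 2 + a * b) ^ 2 := by
    rw [hdet]
    linear_combination (4 * (a ^ 2 + b ^ 2 + a * b) * f1 -
      (2 * a * c + 2 * b * d + a * d + b * c + (a ^ 2 + b ^ 2 + a * b)) * f2) / 3
  have habs : |K.det| = a ^ 2 + b ^ 2 + a * b := by
    rw [← abs_of_nonneg (by nlinarith [sq_nonneg (a + b)] : 0 ≤ a ^ 2 + b ^ 2 + a * b)]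
    exact sq_eq_sq_iff_abs_eq_abs _ _ |>.1 hsq
  rw [habs]
  have hu2 : u 2 = -u 0 - u 1 := by linarith
  rw [hu2]
  simp only [ha, hb, hc, hd] at f1 f2 ⊢
  linear_combination 2 * u 1 ^ 2 * f1 + 2 * u 0 * u 1 * f2

/-! ### The tiling of `MD`. -/

lemma isClosed_anglePlane : IsClosed anglePlane :=
  isClosed_eq (by fun_prop) continuous_const

lemma isClosed_D : IsClosed D := by
  have : D = anglePlane ∩ ⋂ j, {v | 0 ≤ side j v} := by
    ext v; simp [mem_D_iff_side]
  rw [this]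
  exact isClosed_anglePlane.inter (isClosed_iInter fun j =>
    isClosed_le continuous_const (continuous_side j))

lemma isCompact_D : IsCompact D :=
  (isCompact_Icc (a := (0 : Fin 3 → ℝ)) (b := 1)).of_isClosed_subset isClosed_D fun _ hv =>
    ⟨fun i => (apply_le_one_of_mem_D hv i).1, fun i => (apply_le_one_of_mem_D hv i).2⟩

lemma isClosed_translate (g : GL (Fin 3) ℝ) : IsClosed (translate g D) :=
  (isCompact_D.image (by fun_prop : Continuous fun v => g.1 *ᵥ v)).isClosed

lemma planeMeasure_D_ne_zero : planeMeasure D ≠ 0 := by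
  rw [planeMeasure_apply isClosed_D.measurableSet]
  have hopen : IsOpen {p | ∀ j, 0 < side j (planeChart p)} := by
    rw [Set.ofPred_forall]
    exact isOpen_iInter_of_finite fun j =>
      isOpen_lt continuous_const ((continuous_side j).comp continuous_planeChart)
  have hne : {p | ∀ j, 0 < side j (planeChart p)}.Nonempty :=
    ⟨(center 0, center 1), fun j => by
      rw [planeChart_of_mem center_mem.1]; exact center_mem.2 j⟩
  refine ((hopen.measure_pos volume hne).trans_le (measure_mono fun p hp => ?_)).ne'
  exact mem_D_iff_side.2 ⟨planeChart_mem p, fun j => (hp j).le⟩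

lemma planeMeasure_D_ne_top : planeMeasure D ≠ ⊤ := by
  rw [planeMeasure_apply isClosed_D.measurableSet]
  refine ((measure_mono fun p hp => ?_).trans_lt
    (measure_Icc_lt_top (μ := volume) (a := ((0, 0) : ℝ × ℝ)) (b := (1, 1)))).ne
  have h0 := apply_le_one_of_mem_D hp 0
  have h1 := apply_le_one_of_mem_D hp 1
  exact ⟨⟨h0.1, h1.1⟩, ⟨h0.2, h1.2⟩⟩

lemma conjugatesIntoG_of_mem {g : GL (Fin 3) ℝ} (hg : g ∈ G) : ConjugatesIntoG g :=
  ⟨preservesSum_of_mem hg, fun h hh =>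
    ⟨g * h * g⁻¹, G.mul_mem (G.mul_mem hg hh) (G.inv_mem hg), by group⟩⟩

/-- Elements of `G` are isometries of the plane, and the factor on squared lengths is `|det|`. -/
lemma abs_det_of_mem {g : GL (Fin 3) ℝ} (hg : g ∈ G) : |g.1.det| = 1 := by
  have hu : (![1, -1, 0] : Fin 3 → ℝ) 0 + (![1, -1, 0] : Fin 3 → ℝ) 1 +
    (![1, -1, 0] : Fin 3 → ℝ) 2 = 0 := by simp
  have h1 := (conjugatesIntoG_of_mem hg).normSq_mulVec hu
  rw [normSq_mulVec_of_mem hg hu] at h1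
  have h2 : normSq ![1, -1, 0] = 2 := by simp [normSq]; norm_num
  rw [h2] at h1
  linarith

lemma planeMeasure_translate_D {g : GL (Fin 3) ℝ} (hg : g ∈ G) :
    planeMeasure (translate g D) = planeMeasure D := by
  rw [planeMeasure_translate (preservesSum_of_mem hg) isClosed_D.measurableSet,
    abs_det_of_mem hg]
  simp

lemma aedisjoint_translate {g h : GL (Fin 3) ℝ} (hg : g ∈ G) (hh : h ∈ G) (hgh : g ≠ h) :
    AEDisjoint planeMeasure (translate g D) (translate h D) :=
  measure_mono_null (fun _ hw => fixes_of_mem_translate hg hh hw.1 hw.2)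
    (planeMeasure_fixes_eq_zero fun h1 => hgh (mul_inv_eq_one.1 h1))

lemma disjoint_planeInterior {g h : GL (Fin 3) ℝ} (hg : g ∈ G) (hh : h ∈ G) (hgh : g ≠ h) :
    Disjoint (planeInterior (translate g D)) (planeInterior (translate h D)) := by
  rw [Set.disjoint_left]
  rintro v ⟨hvA, hv⟩ ⟨-, hv'⟩
  exact hgh (mul_inv_eq_one.1 (eq_one_of_fixes_nhdsWithin hvA (Filter.inter_mem hv hv')
    fun w hw => fixes_of_mem_translate hg hh hw.1 hw.2))

lemma planeMeasure_image_ne_top {M : GL (Fin 3) ℝ} (hM : PreservesSum M.1) :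
    planeMeasure (translate M D) ≠ ⊤ := by
  rw [planeMeasure_translate hM isClosed_D.measurableSet]
  exact ENNReal.mul_ne_top ENNReal.ofReal_ne_top planeMeasure_D_ne_top

/-- Only finitely many tiles are contained in the image of `D`. -/
lemma finite_tiles {M : GL (Fin 3) ℝ} (hM : PreservesSum M.1) :
    {g | g ∈ G ∧ translate g D ⊆ translate M D}.Finite := by
  set T := {g | g ∈ G ∧ translate g D ⊆ translate M D} with hT
  -- Almost disjoint tiles of equal positive area lie in a set of finite area.
  have h := Measure.finite_const_le_meas_of_disjoint_iUnion₀ planeMeasure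
    (pos_iff_ne_zero.2 planeMeasure_D_ne_zero)
    (As := fun g : T => translate g.1 D)
    (fun g => (isClosed_translate g.1).measurableSet.nullMeasurableSet)
    (fun a b hab => aedisjoint_translate a.2.1 b.2.1 fun h => hab (Subtype.ext h))
    (ne_top_of_le_ne_top (planeMeasure_image_ne_top hM)
      (measure_mono (Set.iUnion_subset fun g => g.2.2)))
  have h' : {g : T | planeMeasure D ≤ planeMeasure (translate g.1 D)} = Set.univ := by
    ext g; simp [planeMeasure_translate_D g.2.1]
  rw [h'] at h
  exact Set.finite_coe_iff.1 (Set.finite_univ_iff.1 h)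

/-- The image of `D` is the union of the tiles it contains. -/
lemma ConjugatesIntoG.image_eq_iUnion {M : GL (Fin 3) ℝ} (hM : ConjugatesIntoG M) :
    translate M D = ⋃ g ∈ {g | g ∈ G ∧ translate g D ⊆ translate M D}, translate g D := by
  refine Set.Subset.antisymm ?_ (Set.iUnion₂_subset fun g hg => hg.2)
  have hcl : IsClosed (⋃ g ∈ {g | g ∈ G ∧ translate g D ⊆ translate M D}, translate g D) :=
    (finite_tiles hM.preservesSum).isClosed_biUnion fun g _ => isClosed_translate g
  -- Points of `MD` off its boundary lie in tiles contained in `MD`; the rest are limits of these,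
  -- and the finite union is closed.
  rintro _ ⟨x, hx, rfl⟩
  have ht : Filter.Tendsto (fun t : ℝ => M.1 *ᵥ ((1 - t) • x + t • center)) (𝓝[>] 0)
      (𝓝 (M.1 *ᵥ x)) :=
    ((by fun_prop : Continuous fun v => M.1 *ᵥ v).tendsto x).comp (tendsto_segment x center)
  refine hcl.mem_of_tendsto ht ?_
  filter_upwards [Ioo_mem_nhdsGT (zero_lt_one' ℝ)] with t ht
  have hy := segment_mem_openD hx ht.1 ht.2.le
  obtain ⟨g, hg, hgD⟩ := exists_mem_D (hM.preservesSum.mem hy.1)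
  have hmem : M.1 *ᵥ ((1 - t) • x + t • center) ∈ translate g⁻¹ D :=
    ⟨_, hgD, GL_inv_mulVec _ _⟩
  refine Set.mem_biUnion (x := g⁻¹) ⟨G.inv_mem hg,
    hM.translate_subset (G.inv_mem hg) hmem fun j => ?_⟩ hmem
  rw [GL_inv_mulVec]
  exact hy.2 j

/-- The image of `D` is tiled by `|det M|` images of `D` under elements of `G`. -/
theorem ConjugatesIntoG.exists_tiling {M : GL (Fin 3) ℝ} (hM : ConjugatesIntoG M) :
    ∃ (n : ℕ) (g : Fin n → GL (Fin 3) ℝ), (n : ℝ) = |M.1.det| ∧ Function.Injective g ∧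
      (∀ i, g i ∈ G) ∧ translate M D = ⋃ i, translate (g i) D := by
  have hfin := finite_tiles hM.preservesSum
  have hU := hM.image_eq_iUnion
  set T := {g | g ∈ G ∧ translate g D ⊆ translate M D} with hT
  have : Finite T := hfin
  let e := Finite.equivFin T
  have hinj : Function.Injective fun i => (e.symm i).1 :=
    Subtype.val_injective.comp e.symm.injective
  have hU' : translate M D = ⋃ i, translate (e.symm i).1 D := by
    rw [hU, Set.biUnion_eq_iUnion]
    exact (e.symm.surjective.iUnion_comp fun g : T => translate g.1 D).symm
  refine ⟨Nat.card T, fun i => (e.symm i).1, ?_, hinj, fun i => (e.symm i).2.1, hU'⟩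
  have h1 : planeMeasure (translate M D) = Nat.card T * planeMeasure D := by
    rw [hU', measure_iUnion₀ (fun i j hij => aedisjoint_translate (e.symm i).2.1 (e.symm j).2.1
      fun h => hij (hinj h)) fun i => (isClosed_translate _).measurableSet.nullMeasurableSet,
      tsum_fintype]
    rw [Finset.sum_congr rfl fun i _ => planeMeasure_translate_D (e.symm i).2.1]
    rw [Finset.sum_const, Finset.card_univ, Fintype.card_fin, nsmul_eq_mul]
  rw [planeMeasure_translate hM.preservesSum isClosed_D.measurableSet,
    ENNReal.mul_left_inj planeMeasure_D_ne_zero planeMeasure_D_ne_top] at h1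
  have h2 := congrArg ENNReal.toReal h1
  rw [ENNReal.toReal_ofReal (abs_nonneg _), ENNReal.toReal_natCast] at h2
  exact h2.symm

/-! ### The image triangle: vertices, angles and edges. -/

/-- The vertices of `D`. -/
noncomputable def vertex : Fin 3 → Fin 3 → ℝ :=
  ![![1, 0, 0], ![1 / 3, 1 / 3, 1 / 3], ![1 / 2, 1 / 2, 0]]

lemma vertex_mem (i : Fin 3) : vertex i ∈ D := by
  rw [mem_D]
  fin_cases i <;> simp [vertex] <;> norm_num

lemma convex_D : Convex ℝ D := by
  intro x hx y hy a b ha hb hab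
  rw [mem_D_iff_side] at *
  refine ⟨convex_anglePlane hx.1 hy.1 ha hb hab, fun j => ?_⟩
  rw [map_add, map_smul, map_smul]
  exact add_nonneg (mul_nonneg ha (hx.2 j)) (mul_nonneg hb (hy.2 j))

lemma D_eq_convexHull : D = convexHull ℝ {vertex 0, vertex 1, vertex 2} := by
  refine Set.Subset.antisymm (fun v hv => ?_) (convexHull_min ?_ convex_D)
  · obtain ⟨h0, h1, h2, h3⟩ := mem_D.1 hv
    have hmem : ∀ i, vertex i ∈ convexHull ℝ {vertex 0, vertex 1, vertex 2} := fun i =>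
      subset_convexHull _ _ (by fin_cases i <;> simp)
    -- The weights are the barycentric coordinates of `v`.
    have := (convex_convexHull ℝ {vertex 0, vertex 1, vertex 2}).sum_mem
      (t := Finset.univ) (w := ![v 0 - v 1, 3 * v 2, 2 * (v 1 - v 2)]) (z := vertex)
      (fun i _ => by fin_cases i <;> simp <;> linarith)
      (by simp [Fin.sum_univ_three]; linarith) fun i _ => hmem i
    convert this
    ext i
    rw [Fin.sum_univ_three]
    fin_cases i <;> simp [vertex] <;> ring
  · rintro v (rfl | rfl | rfl) <;> exact vertex_mem _

lemma image_D_eq_convexHull (M : GL (Fin 3) ℝ) :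
    translate M D = convexHull ℝ
      {M.1 *ᵥ vertex 0, M.1 *ᵥ vertex 1, M.1 *ᵥ vertex 2} := by
  have := (mulVecLin M.1).image_convexHull (s := {vertex 0, vertex 1, vertex 2})
  rw [← D_eq_convexHull] at this
  simp only [Set.image_insert_eq, Set.image_singleton, mulVecLin_apply] at this
  exact this

/-- The Euclidean inner product. -/
def dot (u w : Fin 3 → ℝ) : ℝ := u 0 * w 0 + u 1 * w 1 + u 2 * w 2

lemma ConjugatesIntoG.dot_mulVec {M : GL (Fin 3) ℝ} (hM : ConjugatesIntoG M) {u w : Fin 3 → ℝ}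
    (hu : u 0 + u 1 + u 2 = 0) (hw : w 0 + w 1 + w 2 = 0) :
    dot (M.1 *ᵥ u) (M.1 *ᵥ w) = |M.1.det| * dot u w := by
  have huw : (u + w) 0 + (u + w) 1 + (u + w) 2 = 0 := by
    simp only [Pi.add_apply]; linear_combination hu + hw
  have h1 := hM.normSq_mulVec hu
  have h2 := hM.normSq_mulVec hw
  have h3 := hM.normSq_mulVec huw
  rw [mulVec_add] at h3
  simp only [normSq, dot, Pi.add_apply] at *
  linear_combination (h3 - h1 - h2) / 2

lemma angleAt_eq {p q r : Fin 3 → ℝ} {θ : ℝ} (h0 : 0 ≤ θ) (hπ : θ ≤ Real.pi)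
    (hpq : 0 < normSq (p - q)) (hrq : 0 < normSq (r - q))
    (h : dot (p - q) (r - q) = Real.cos θ * Real.sqrt (normSq (p - q) * normSq (r - q))) :
    angleAt p q r = θ := by
  have hn : ∀ u : Fin 3 → ℝ, ‖(WithLp.toLp 2 u : EuclideanSpace ℝ (Fin 3))‖ =
      Real.sqrt (normSq u) := fun u => by
    rw [EuclideanSpace.norm_eq]
    simp [Fin.sum_univ_three, normSq]
  have hi : ∀ u w : Fin 3 → ℝ, inner ℝ (WithLp.toLp 2 u : EuclideanSpace ℝ (Fin 3))
      (WithLp.toLp 2 w) = dot u w := fun u w => by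
    simp [PiLp.inner_apply, Fin.sum_univ_three, dot, mul_comm]
  rw [angleAt, EuclideanGeometry.angle, InnerProductGeometry.angle, vsub_eq_sub, vsub_eq_sub,
    ← WithLp.toLp_sub, ← WithLp.toLp_sub, hn, hn, hi, h, ← Real.sqrt_mul hpq.le,
    mul_div_assoc, div_self (Real.sqrt_pos.2 (mul_pos hpq hrq)).ne', mul_one,
    Real.arccos_cos h0 hπ]

lemma ConjugatesIntoG.angleAt_eq {M : GL (Fin 3) ℝ} (hM : ConjugatesIntoG M) {p q r : Fin 3 → ℝ}
    (hp : p ∈ anglePlane) (hq : q ∈ anglePlane) (hr : r ∈ anglePlane) {θ a : ℝ} (h0 : 0 ≤ θ)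
    (hπ : θ ≤ Real.pi) (hpq : 0 < normSq (p - q)) (hrq : 0 < normSq (r - q)) (ha : 0 ≤ a)
    (ha2 : normSq (p - q) * normSq (r - q) = a ^ 2) (h : dot (p - q) (r - q) = Real.cos θ * a) :
    angleAt (M.1 *ᵥ p) (M.1 *ᵥ q) (M.1 *ᵥ r) = θ := by
  have hdet : 0 < |M.1.det| := abs_pos.2 (isUnit_iff_ne_zero.1 ((isUnit_iff_isUnit_det _).1 M.isUnit))
  rw [mem_anglePlane] at hp hq hr
  have hu : (p - q) 0 + (p - q) 1 + (p - q) 2 = 0 := by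
    simp only [Pi.sub_apply]; linear_combination hp - hq
  have hw : (r - q) 0 + (r - q) 1 + (r - q) 2 = 0 := by
    simp only [Pi.sub_apply]; linear_combination hr - hq
  apply TriangleDynamics.angleAt_eq h0 hπ <;> simp only [← mulVec_sub, hM.normSq_mulVec hu,
    hM.normSq_mulVec hw, hM.dot_mulVec hu hw]
  · positivity
  · positivity
  · have : |M.1.det| * normSq (p - q) * (|M.1.det| * normSq (r - q)) = (|M.1.det| * a) ^ 2 := by
      linear_combination |M.1.det| ^ 2 * ha2
    rw [this, Real.sqrt_sq (by positivity), h]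
    ring

lemma ConjugatesIntoG.angles {M : GL (Fin 3) ℝ} (hM : ConjugatesIntoG M) :
    angleAt (M.1 *ᵥ vertex 1) (M.1 *ᵥ vertex 0) (M.1 *ᵥ vertex 2) = Real.pi / 6 ∧
    angleAt (M.1 *ᵥ vertex 0) (M.1 *ᵥ vertex 1) (M.1 *ᵥ vertex 2) = Real.pi / 3 ∧
    angleAt (M.1 *ᵥ vertex 0) (M.1 *ᵥ vertex 2) (M.1 *ᵥ vertex 1) = Real.pi / 2 := by
  have hv := fun i => (vertex_mem i).1
  have hπ := Real.pi_pos
  have h3 : Real.sqrt 3 ^ 2 = 3 := Real.sq_sqrt (by norm_num)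
  -- Each `a` is the product of the two side lengths of `D` at the vertex; the squared side lengths
  -- are `2/3`, `1/2` and `1/6`.
  refine ⟨hM.angleAt_eq (a := Real.sqrt 3 / 3) (hv _) (hv _) (hv _) ?_ ?_ ?_ ?_ ?_ ?_ ?_,
    hM.angleAt_eq (a := 1 / 3) (hv _) (hv _) (hv _) ?_ ?_ ?_ ?_ ?_ ?_ ?_,
    hM.angleAt_eq (a := Real.sqrt 3 / 6) (hv _) (hv _) (hv _) ?_ ?_ ?_ ?_ ?_ ?_ ?_⟩
  all_goals try rw [Real.cos_pi_div_six]
  all_goals try rw [Real.cos_pi_div_three]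
  all_goals try rw [Real.cos_pi_div_two]
  all_goals first
    | linarith
    | positivity
    | (simp [normSq, dot, vertex]; norm_num; done)
    | (simp [normSq, dot, vertex]; linarith)

/-- The image of a segment on a side of `D` lies on a single reflection line. -/
lemma ConjugatesIntoG.edge {M : GL (Fin 3) ℝ} (hM : ConjugatesIntoG M) (j : Fin 3)
    {x y : Fin 3 → ℝ} (hxy : x ≠ y) (hx : x ∈ anglePlane) (hy : y ∈ anglePlane)
    (hx0 : side j x = 0) (hy0 : side j y = 0) :
    segment ℝ (M.1 *ᵥ x) (M.1 *ᵥ y) ⊆ reflectionSet ∧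
      ∃ L, IsReflectionLine L ∧ segment ℝ (M.1 *ᵥ x) (M.1 *ᵥ y) ⊆ L := by
  obtain ⟨h, hh, h1, hfix⟩ := hM.exists_reflection j
  have hA := fun {v : Fin 3 → ℝ} => hM.preservesSum.mem (v := v)
  have hseg : ∀ z ∈ segment ℝ (M.1 *ᵥ x) (M.1 *ᵥ y), z ∈ anglePlane ∧ h.1 *ᵥ z = z := by
    intro z hz
    refine ⟨convex_anglePlane.segment_subset (hA hx) (hA hy) hz, ?_⟩
    obtain ⟨a, b, -, -, -, rfl⟩ := hz
    rw [mulVec_add, mulVec_smul, mulVec_smul, hfix x hx0, hfix y hy0]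
  obtain ⟨L, hL, hL'⟩ := exists_reflectionLine hh h1
    (fun e => hxy (by rw [← GL_inv_mulVec M x, e, GL_inv_mulVec])) (hA hx) (hA hy)
    (hfix x hx0) (hfix y hy0)
  exact ⟨fun z hz => ⟨(hseg z hz).1, h, hh, h1, (hseg z hz).2⟩, L, hL,
    fun z hz => hL' z (hseg z hz).1 (hseg z hz).2⟩

lemma side_vertex : side 0 (vertex 1) = 0 ∧ side 0 (vertex 2) = 0 ∧ side 1 (vertex 0) = 0 ∧
    side 1 (vertex 1) = 0 ∧ side 2 (vertex 0) = 0 ∧ side 2 (vertex 2) = 0 := by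
  simp [side, vertex]

lemma vertex_injective : Function.Injective vertex := by
  intro i j h
  have h0 := congrFun h 0
  fin_cases i <;> fin_cases j <;> first | rfl | (exfalso; simp [vertex] at h0)

/-! ### Area on `D`. -/

instance : CompactSpace D := isCompact_iff_compactSpace.1 isCompact_D

/-- The point `center` as an element of `D`. -/
noncomputable def centerD : D := ⟨center, openD_subset center_mem⟩

instance : Nonempty D := ⟨centerD⟩

/-- `Measure.comap` defaults to zero for unsuitable maps, so `area` has its intended meaning only
through this. -/
lemma measurableEmbedding_coordinates :
    MeasurableEmbedding (fun v : D => ((v.1 0, v.1 1) : ℝ × ℝ)) := by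
  refine (Continuous.isClosedEmbedding (((continuous_apply 0).comp continuous_subtype_val).prodMk
    ((continuous_apply 1).comp continuous_subtype_val)) fun v w h => ?_).measurableEmbedding
  have := congrArg planeChart h
  simp only [Function.comp_apply] at this
  rw [planeChart_of_mem v.2.1, planeChart_of_mem w.2.1] at this
  exact Subtype.ext this

lemma area_apply {S : Set D} (hS : MeasurableSet S) : area S = planeMeasure (Subtype.val '' S) := by
  rw [area, measurableEmbedding_coordinates.comap_apply,
    planeMeasure_apply (isClosed_D.measurableSet.subtype_image hS)]
  congr 1
  ext p
  constructor
  · rintro ⟨v, hv, rfl⟩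
    exact ⟨v, hv, (planeChart_of_mem v.2.1).symm⟩
  · rintro ⟨v, hv, hvp⟩
    refine ⟨v, hv, ?_⟩
    simp [hvp, planeChart]

lemma area_univ : area Set.univ = planeMeasure D := by
  rw [area_apply .univ, Set.image_univ, Subtype.range_coe]

lemma isProbabilityMeasure_normalizedArea : IsProbabilityMeasure normalizedArea := by
  constructor
  rw [normalizedArea, Measure.smul_apply, smul_eq_mul, area_univ,
    ENNReal.inv_mul_cancel planeMeasure_D_ne_zero planeMeasure_D_ne_top]

/-! ### Inverse branches, the Markov partition and the Bernoulli coding. -/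

/-- The data of a linear triangle map together with the tiling of the image of `D`. -/
structure TiledMap (M : GL (Fin 3) ℝ) {n : ℕ} (g : Fin n → GL (Fin 3) ℝ) (f : D → D) : Prop where
  conj : ConjugatesIntoG M
  card_eq : (n : ℝ) = |M.1.det|
  injective : Function.Injective g
  mem : ∀ i, g i ∈ G
  image_eq : translate M D = ⋃ i, translate (g i) D
  reexpr : ∀ v : D, Reexpr (f v).1 (M.1 *ᵥ v.1)

namespace TiledMap

variable {M : GL (Fin 3) ℝ} {n : ℕ} {g : Fin n → GL (Fin 3) ℝ} {f : D → D}

/-- The set of points of `D` that are mapped to the `i`-th tile. -/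
def piece (M : GL (Fin 3) ℝ) (g : Fin n → GL (Fin 3) ℝ) (i : Fin n) : Set D :=
  {v : D | M.1 *ᵥ v.1 ∈ translate (g i) D}

lemma branch_mem (h : TiledMap M g f) (i : Fin n) {x : Fin 3 → ℝ} (hx : x ∈ D) :
    (M⁻¹ * g i).1 *ᵥ x ∈ D := by
  rw [GL_mul_mulVec, ← mem_image_D_iff, h.image_eq]
  exact Set.mem_iUnion.2 ⟨i, x, hx, rfl⟩

/-- The inverse branches of the linear triangle map. -/
def branch (h : TiledMap M g f) (i : Fin n) (x : D) : D :=
  ⟨(M⁻¹ * g i).1 *ᵥ x.1, h.branch_mem i x.2⟩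

lemma mulVec_branch (h : TiledMap M g f) (i : Fin n) (x : D) :
    M.1 *ᵥ (h.branch i x).1 = (g i).1 *ᵥ x.1 := by
  change M.1 *ᵥ ((M⁻¹ * g i).1 *ᵥ x.1) = _
  rw [GL_mul_mulVec, GL_mulVec_inv]

lemma continuous_branch (h : TiledMap M g f) (i : Fin n) : Continuous (h.branch i) :=
  ((by fun_prop : Continuous fun v => (M⁻¹ * g i).1 *ᵥ v).comp continuous_subtype_val).subtype_mk _

lemma piece_eq_range (h : TiledMap M g f) (i : Fin n) : piece M g i = Set.range (h.branch i) := by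
  ext v
  constructor
  · rintro ⟨x, hx, hxv⟩
    refine ⟨⟨x, hx⟩, Subtype.ext ?_⟩
    dsimp only at hxv
    change (M⁻¹ * g i).1 *ᵥ x = v.1
    rw [GL_mul_mulVec, hxv, GL_inv_mulVec]
  · rintro ⟨x, rfl⟩
    exact ⟨x, x.2, (h.mulVec_branch i x).symm⟩

/-- `M` sends the branch point to `gᵢ x`, a re-expression of `x`, and `D` contains only one point of
the class. -/
lemma map_branch (h : TiledMap M g f) (i : Fin n) (x : D) : f (h.branch i x) = x := by
  refine Subtype.ext ?_
  have h1 := h.reexpr (h.branch i x)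
  rw [h.mulVec_branch] at h1
  exact (h1.trans (Reexpr.of_mem (h.mem i) x.2.1)).eq_of_mem_D (f _).2 x.2

lemma map_eq (h : TiledMap M g f) {i : Fin n} {v : D} (hv : v ∈ piece M g i) :
    (f v).1 = ((g i)⁻¹ * M).1 *ᵥ v.1 := by
  rw [h.piece_eq_range] at hv
  obtain ⟨x, rfl⟩ := hv
  rw [h.map_branch, GL_mul_mulVec, h.mulVec_branch, GL_inv_mulVec]

lemma iUnion_piece (h : TiledMap M g f) : ⋃ i, piece M g i = Set.univ := by
  refine Set.eq_univ_of_forall fun v => ?_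
  have : M.1 *ᵥ v.1 ∈ translate M D := ⟨v, v.2, rfl⟩
  rw [h.image_eq] at this
  simpa [piece] using this

lemma isClosed_piece (i : Fin n) : IsClosed (piece M g i) :=
  (isClosed_translate (g i)).preimage
    ((by fun_prop : Continuous fun v => M.1 *ᵥ v).comp continuous_subtype_val)

lemma continuousOn (h : TiledMap M g f) (i : Fin n) : ContinuousOn f (piece M g i) := by
  rw [Topology.IsInducing.subtypeVal.continuousOn_iff]
  exact ContinuousOn.congr ((by fun_prop : Continuous fun v => ((g i)⁻¹ * M).1 *ᵥ v).comp
    continuous_subtype_val).continuousOn fun v hv => h.map_eq hv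

lemma continuous (h : TiledMap M g f) : Continuous f :=
  (locallyFinite_of_finite _).continuous h.iUnion_piece isClosed_piece h.continuousOn

lemma injOn (h : TiledMap M g f) (i : Fin n) : Set.InjOn f (piece M g i) := by
  rw [h.piece_eq_range]
  rintro _ ⟨x, rfl⟩ _ ⟨y, rfl⟩ hxy
  rw [h.map_branch, h.map_branch] at hxy
  rw [hxy]

/-- All transitions between pieces are allowed, which is why the full shift appears. -/
lemma image_piece (h : TiledMap M g f) (i : Fin n) : f '' piece M g i = Set.univ := by
  rw [h.piece_eq_range, ← Set.range_comp]
  exact Set.range_eq_univ.2 fun x => ⟨x, h.map_branch i x⟩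

lemma dense_openD : Dense (Subtype.val ⁻¹' openD : Set D) := by
  intro v
  rw [closure_subtype, Subtype.image_preimage_coe, Set.inter_eq_right.2 openD_subset]
  exact D_subset_closure_openD v.2

lemma branch_mem_interior (h : TiledMap M g f) (i : Fin n) {x : D} (hx : x.1 ∈ openD) :
    h.branch i x ∈ interior (piece M g i) := by
  have hc : Continuous fun v : D => ((g i)⁻¹ * M).1 *ᵥ v.1 :=
    (by fun_prop : Continuous fun v => ((g i)⁻¹ * M).1 *ᵥ v).comp continuous_subtype_val
  have hpos : ∀ j, 0 < side j (((g i)⁻¹ * M).1 *ᵥ (h.branch i x).1) := fun j => by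
    rw [GL_mul_mulVec, h.mulVec_branch, GL_inv_mulVec]
    exact hx.2 j
  rw [mem_interior_iff_mem_nhds]
  have hev : ∀ᶠ v : D in 𝓝 (h.branch i x), ∀ j, 0 < side j (((g i)⁻¹ * M).1 *ᵥ v.1) :=
    Filter.eventually_all.2 fun j => ((continuous_side j).comp hc).continuousAt.eventually
      (lt_mem_nhds (hpos j))
  filter_upwards [hev] with v hv
  refine mem_image_D_iff.2 ?_
  rw [← GL_mul_mulVec]
  exact mem_D_iff_side.2 ⟨((preservesSum_of_mem (h.mem i)).inv.mul h.conj.preservesSum).mem v.2.1,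
    fun j => (hv j).le⟩

lemma closure_interior_piece (h : TiledMap M g f) (i : Fin n) :
    closure (interior (piece M g i)) = piece M g i := by
  refine Set.Subset.antisymm ((closure_mono interior_subset).trans (isClosed_piece i).closure_eq.le)
    ?_
  rw [h.piece_eq_range]
  rintro _ ⟨x, rfl⟩
  rw [← h.piece_eq_range]
  refine closure_mono ?_ (image_closure_subset_closure_image (h.continuous_branch i)
    ⟨x, dense_openD x, rfl⟩)
  rintro _ ⟨y, hy, rfl⟩
  exact h.branch_mem_interior i hy

lemma fixes_of_mem_pieces (h : TiledMap M g f) {i j : Fin n} {v : D} (hi : v ∈ piece M g i)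
    (hj : v ∈ piece M g j) : (M⁻¹ * (g i * (g j)⁻¹) * M).1 *ᵥ v.1 = v.1 := by
  rw [GL_mul_mulVec, GL_mul_mulVec, fixes_of_mem_translate (h.mem i) (h.mem j) hi hj,
    GL_inv_mulVec]

lemma conj_ne_one (h : TiledMap M g f) {i j : Fin n} (hij : i ≠ j) :
    M⁻¹ * (g i * (g j)⁻¹) * M ≠ 1 := by
  intro h1
  apply hij (h.injective _)
  have : g i * (g j)⁻¹ = M * (M⁻¹ * (g i * (g j)⁻¹) * M) * M⁻¹ := by group
  rw [h1] at this
  exact mul_inv_eq_one.1 (by simpa using this)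

lemma disjoint_interior (h : TiledMap M g f) {i j : Fin n} (hij : i ≠ j) :
    Disjoint (interior (piece M g i)) (interior (piece M g j)) := by
  rw [Set.disjoint_iff_inter_eq_empty]
  by_contra hne
  -- Interiors here are relative to `D`; at a point of `openD` they are also neighbourhoods in the
  -- plane, so rigidity applies.
  obtain ⟨v, hvU, hv⟩ := dense_openD.inter_open_nonempty _
    (isOpen_interior.inter isOpen_interior) (Set.nonempty_iff_ne_empty.2 hne)
  refine h.conj_ne_one hij (eq_one_of_fixes_nhdsWithin v.2.1
    (S := Subtype.val '' (interior (piece M g i) ∩ interior (piece M g j))) ?_ ?_)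
  · have h1 := mem_nhds_subtype_iff_nhdsWithin.1
      ((isOpen_interior.inter isOpen_interior).mem_nhds hvU)
    exact nhdsWithin_le_of_mem (Filter.mem_of_superset (openD_mem_nhdsWithin hv) openD_subset) h1
  · rintro _ ⟨w, hw, rfl⟩
    exact h.fixes_of_mem_pieces (interior_subset hw.1) (interior_subset hw.2)

theorem isMarkovPartition (h : TiledMap M g f) : IsMarkovPartition f (piece M g) where
  nonempty i := ⟨h.branch i centerD, by rw [h.piece_eq_range]; exact ⟨_, rfl⟩⟩
  closure_interior := h.closure_interior_piece
  cover := h.iUnion_piece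
  disjoint _ _ := h.disjoint_interior
  continuousOn := h.continuousOn
  injOn := h.injOn
  markov i := ⟨Set.univ, by rw [Set.biUnion_univ, h.iUnion_piece, h.image_piece]⟩

lemma card_pos (h : TiledMap M g f) : 0 < n := by
  have : 0 < |M.1.det| :=
    abs_pos.2 (isUnit_iff_ne_zero.1 ((isUnit_iff_isUnit_det _).1 M.isUnit))
  rw [← h.card_eq] at this
  exact_mod_cast this

lemma abs_det_branch (h : TiledMap M g f) (i : Fin n) : |(M⁻¹ * g i).1.det| = (n : ℝ)⁻¹ := by
  have h1 : (M⁻¹).1.det * M.1.det = 1 := by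
    rw [← det_mul, ← Units.val_mul]; simp
  rw [Units.val_mul, det_mul, abs_mul, abs_det_of_mem (h.mem i), mul_one, h.card_eq]
  exact eq_inv_of_mul_eq_one_left (by rw [← abs_mul, h1, abs_one])

lemma area_inter_piece (h : TiledMap M g f) (i : Fin n) {S : Set D} (hS : MeasurableSet S) :
    n * area (S ∩ piece M g i) = area (h.branch i ⁻¹' S) := by
  have hm : MeasurableSet (h.branch i ⁻¹' S) := (h.continuous_branch i).measurable hS
  rw [area_apply (hS.inter (isClosed_piece i).measurableSet), area_apply hm]
  have : Subtype.val '' (S ∩ piece M g i) =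
      translate (M⁻¹ * g i) (Subtype.val '' (h.branch i ⁻¹' S)) := by
    rw [h.piece_eq_range]
    ext w
    constructor
    · rintro ⟨_, ⟨hv, x, rfl⟩, rfl⟩
      exact ⟨x, ⟨x, hv, rfl⟩, rfl⟩
    · rintro ⟨_, ⟨x, hx, rfl⟩, rfl⟩
      exact ⟨h.branch i x, ⟨hx, x, rfl⟩, rfl⟩
  rw [this, planeMeasure_translate (h.conj.preservesSum.inv.mul (preservesSum_of_mem (h.mem i)))
    (isClosed_D.measurableSet.subtype_image hm), h.abs_det_branch, ← mul_assoc,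
    ENNReal.ofReal_inv_of_pos (Nat.cast_pos.2 h.card_pos), ENNReal.ofReal_natCast,
    ENNReal.mul_inv_cancel (by exact_mod_cast h.card_pos.ne') (ENNReal.natCast_ne_top n), one_mul]

lemma aedisjoint_piece (h : TiledMap M g f) {i j : Fin n} (hij : i ≠ j) :
    area (piece M g i ∩ piece M g j) = 0 := by
  rw [area_apply ((isClosed_piece i).inter (isClosed_piece j)).measurableSet]
  refine measure_mono_null ?_ (planeMeasure_fixes_eq_zero (h.conj_ne_one hij))
  rintro _ ⟨v, hv, rfl⟩
  exact h.fixes_of_mem_pieces hv.1 hv.2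

/-- Each branch scales area by `1 / n`, and the pieces overlap in null sets. -/
lemma isBranchInvariant (h : TiledMap M g f) : IsBranchInvariant h.branch normalizedArea := by
  have key : (n : ENNReal) • area = ∑ i, area.map (h.branch i) := by
    ext S hS
    simp only [Measure.smul_apply, smul_eq_mul, Measure.coe_finsetSum, Finset.sum_apply]
    have h1 : S = ⋃ i, S ∩ piece M g i := by rw [← Set.inter_iUnion, h.iUnion_piece, Set.inter_univ]
    have h2 : area S = ∑ i, area (S ∩ piece M g i) := by
      conv_lhs => rw [h1]
      rw [measure_iUnion₀ (fun i j hij => measure_mono_null (Set.inter_subset_inter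
        Set.inter_subset_right Set.inter_subset_right) (h.aedisjoint_piece hij))
        fun i => (hS.inter (isClosed_piece i).measurableSet).nullMeasurableSet, tsum_fintype]
    rw [h2, Finset.mul_sum]
    refine Finset.sum_congr rfl fun i _ => ?_
    rw [h.area_inter_piece i hS, Measure.map_apply (h.continuous_branch i).measurable hS]
  unfold IsBranchInvariant normalizedArea
  rw [smul_comm, key, Finset.smul_sum]
  exact Finset.sum_congr rfl fun i _ => (Measure.map_smul _ _ _).symm

/-- Outside the degenerate case the inverse branches contract the Euclidean distance. -/
lemma uniformlyContracting (h : TiledMap M g f) (hn : 1 < n) :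
    UniformlyContracting h.branch (fun x y : D => Real.sqrt (normSq (x.1 - y.1)))
      (Real.sqrt (n : ℝ)⁻¹) (Real.sqrt 3) where
  dist_le x y := by
    rw [Subtype.dist_eq, dist_pi_le_iff (Real.sqrt_nonneg _)]
    intro i
    rw [Real.dist_eq]
    refine Real.abs_le_sqrt ?_
    fin_cases i <;> simp [normSq] <;> nlinarith [sq_nonneg (x.1 0 - y.1 0),
      sq_nonneg (x.1 1 - y.1 1), sq_nonneg (x.1 2 - y.1 2)]
  contract i x y := by
    have hn0 : (0 : ℝ) < n := Nat.cast_pos.2 h.card_pos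
    have hsum : ∀ {x y : D}, (x.1 - y.1) 0 + (x.1 - y.1) 1 + (x.1 - y.1) 2 = 0 := fun {x y} => by
      have := mem_anglePlane.1 x.2.1
      have := mem_anglePlane.1 y.2.1
      simp only [Pi.sub_apply]; linarith
    -- `M` carries branch points to `gᵢ x` and `gᵢ y`: it multiplies squared length by `n`, and `gᵢ`
    -- preserves it.
    have h1 := h.conj.normSq_mulVec (hsum (x := h.branch i x) (y := h.branch i y))
    rw [mulVec_sub, h.mulVec_branch, h.mulVec_branch, ← mulVec_sub,
      normSq_mulVec_of_mem (h.mem i) hsum, ← h.card_eq] at h1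
    rw [← Real.sqrt_mul (inv_nonneg.2 hn0.le), h1, inv_mul_cancel_left₀ hn0.ne']
  bounded x y := by
    refine Real.sqrt_le_sqrt ?_
    have hb : ∀ i, (x.1 i - y.1 i) ^ 2 ≤ 1 := fun i => by
      have h1 := apply_le_one_of_mem_D x.2 i
      have h2 := apply_le_one_of_mem_D y.2 i
      rw [sq_le_one_iff_abs_le_one, abs_le]
      constructor <;> linarith
    simp only [normSq, Pi.sub_apply]
    linarith [hb 0, hb 1, hb 2]
  r_nonneg := Real.sqrt_nonneg _
  r_lt_one := by
    rw [Real.sqrt_lt' one_pos, one_pow]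
    exact inv_lt_one_of_one_lt₀ (Nat.one_lt_cast.2 hn)
  continuous := h.continuous_branch

/-- Outside the degenerate case the itineraries give a semiconjugacy from the Bernoulli shift, and
the map is mixing and ergodic. -/
theorem bernoulli (h : TiledMap M g f) (hdet : |M.1.det| ≠ 1) :
    (∃ c : (ℕ → Fin n) → D, Continuous c ∧ Function.Surjective c ∧ Function.Semiconj c shift f ∧
      (∀ ω k, f^[k] (c ω) ∈ piece M g (ω k)) ∧
      MeasurePreserving c (bernoulliMeasure n) normalizedArea) ∧
    IsMixing f normalizedArea ∧ Ergodic f normalizedArea := by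
  have hpos := h.card_pos
  have hn : 1 < n := by
    refine lt_of_le_of_ne hpos fun e => hdet ?_
    rw [← h.card_eq, ← e]; simp
  have : NeZero n := ⟨hpos.ne'⟩
  have := isProbabilityMeasure_normalizedArea
  have := isProbabilityMeasure_bernoulliMeasure n
  have hU := h.uniformlyContracting hn
  have hφ : ∀ i, Measurable (h.branch i) := fun i => (h.continuous_branch i).measurable
  have hmix := hU.isMixing h.isBranchInvariant h.map_branch h.continuous.measurable
  refine ⟨?_, hmix, hmix.ergodic⟩
  obtain ⟨c, hcc, hc⟩ := hU.exists_coding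
  -- The pushed-forward Bernoulli measure and normalized area are both branch-invariant, hence
  -- equal.
  have hmap := isBranchInvariant_map_coding hφ hcc.measurable hc
  have := Measure.isProbabilityMeasure_map (μ := bernoulliMeasure n) hcc.measurable.aemeasurable
  refine ⟨c, hcc, hU.coding_surjective h.map_branch hc fun x => ?_,
    semiconj_of_coding h.map_branch hc, fun ω k => ?_, hcc.measurable,
    hU.measure_unique hmap h.isBranchInvariant⟩
  · have hx : x ∈ ⋃ i, piece M g i := by rw [h.iUnion_piece]; trivial
    obtain ⟨i, hi⟩ := Set.mem_iUnion.1 hx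
    rw [h.piece_eq_range] at hi
    exact ⟨i, hi⟩
  · rw [iterate_coding h.map_branch hc, h.piece_eq_range]
    exact ⟨_, rfl⟩

end TiledMap

end TriangleDynamics

open TriangleDynamics MeasureTheory in
theorem mainTheorem2 (M : Matrix (Fin 3) (Fin 3) ℝ) (f : TriangleDynamics.D → TriangleDynamics.D)
    (hf : IsLinearTriangleMap f M) :
    -- the image of the fundamental domain is a 30-60-90 triangle with edges on reflection lines
    (∃ p q r : Fin 3 → ℝ, p ∈ anglePlane ∧ q ∈ anglePlane ∧ r ∈ anglePlane ∧
      (fun v => M.mulVec v) '' TriangleDynamics.D = convexHull ℝ {p, q, r} ∧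
      angleAt q p r = Real.pi / 6 ∧ angleAt p q r = Real.pi / 3 ∧ angleAt p r q = Real.pi / 2 ∧
      (segment ℝ p q ⊆ reflectionSet ∧ ∃ L, IsReflectionLine L ∧ segment ℝ p q ⊆ L) ∧
      (segment ℝ q r ⊆ reflectionSet ∧ ∃ L, IsReflectionLine L ∧ segment ℝ q r ⊆ L) ∧
      (segment ℝ r p ⊆ reflectionSet ∧ ∃ L, IsReflectionLine L ∧ segment ℝ r p ⊆ L)) ∧
    -- the image is tiled by `|det M|` copies of the fundamental domain
    ∃ (n : ℕ) (g : Fin n → GL (Fin 3) ℝ), (n : ℝ) = |M.det| ∧ (∀ i, g i ∈ G) ∧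
      (fun v => M.mulVec v) '' TriangleDynamics.D = ⋃ i, translate (g i) TriangleDynamics.D ∧
      (∀ i j, i ≠ j → Disjoint (planeInterior (translate (g i) TriangleDynamics.D))
        (planeInterior (translate (g j) TriangleDynamics.D))) ∧
      -- the preimages of the tiles form a Markov partition
      IsMarkovPartition f
        (fun i => {v : TriangleDynamics.D | M.mulVec v.1 ∈ translate (g i) TriangleDynamics.D}) ∧
      -- outside the degenerate case `|det M| = 1` the itineraries give the semiconjugacy,
      -- and the map is mixing and ergodic
      (|M.det| ≠ 1 →
        (∃ h : (ℕ → Fin n) → TriangleDynamics.D, Continuous h ∧ Function.Surjective h ∧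
          Function.Semiconj h shift f ∧
          (∀ ω k, M.mulVec (f^[k] (h ω)).1 ∈ translate (g (ω k)) TriangleDynamics.D) ∧
          MeasurePreserving h (bernoulliMeasure n) normalizedArea) ∧
        IsMixing f normalizedArea ∧ Ergodic f normalizedArea) := by
  obtain ⟨hM, hre⟩ := hf
  obtain ⟨M, rfl⟩ := hM.invertible
  have hc := hM.conjugatesIntoG
  have hv := fun i => (vertex_mem i).1
  obtain ⟨s1, s2, s3, s4, s5, s6⟩ := side_vertex
  refine ⟨⟨_, _, _, hc.preservesSum.mem (hv 0), hc.preservesSum.mem (hv 1),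
    hc.preservesSum.mem (hv 2), image_D_eq_convexHull M, hc.angles.1, hc.angles.2.1, hc.angles.2.2,
    hc.edge 1 (vertex_injective.ne (by decide)) (hv 0) (hv 1) s3 s4,
    hc.edge 0 (vertex_injective.ne (by decide)) (hv 1) (hv 2) s1 s2,
    hc.edge 2 (vertex_injective.ne (by decide)) (hv 2) (hv 0) s6 s5⟩, ?_⟩
  obtain ⟨n, g, hn, hinj, hg, hU⟩ := hc.exists_tiling
  have ht : TiledMap M g f := ⟨hc, hn, hinj, hg, hU, hre⟩
  exact ⟨n, g, hn, hg, hU, fun i j hij => disjoint_planeInterior (hg i) (hg j) (hinj.ne hij),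
    ht.isMarkovPartition, ht.bernoulli⟩
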